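/- Let $a_1=(0,0)$, $a_2=(1,0)$, $a_3=(1/2,\sqrt3/2)$, let $T_0$ be the triangle with vertices $a_1,a_2,a_3$, and put $T_{n+1}=T_n\cup(T_n+2^na_2)\cup(T_n+2^na_3)$ for $n\ge 0$, so that $T_n$ consists of $3^n$ translates of the unit triangle $T_0$. The Sierpinski lattice is the graph whose vertex set $\mathbb G\subset\mathbb R^2$ consists of the vertices of the unit triangles of all the $T_n$ and of their mirror images in the $y$-axis, and in which two distinct vertices $x,y$ are adjacent, $x\sim y$, if they are vertices of a common unit triangle of some $T_n$ or of the mirror image of some $T_n$. Let $$\Delta f(x)=\sum_{y\sim x}\bigl(f(y)-f(x)\bigr),\qquad x\in\mathbb G,$$ be the graph Laplacian on $\ell^2(\mathbb G)$. Let $\{V_\omega(x)\}_{x\in\mathbb G}$ be independent, identically distributed real random variables with common distribution $P_0$, an arbitrary Borel probability measure on $\mathbb R$, and let $H_\omega=-\Delta+V_\omega$ be the Anderson model on $\ell^2(\mathbb G)$, where $V_\omega$ acts as the multiplication operator (with its natural domain $\{f\in\ell^2(\mathbb G): V_\omega f\in\ell^2(\mathbb G)\}$ if it is unbounded). Let $\operatorname{supp}P_0=\{x\in\mathbb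 R: P_0(x-\varepsilon,x+\varepsilon)>0\text{ for all }\varepsilon>0\}$, write $\sigma(\cdot)$ for the spectrum, and for sets of numbers let $A+B=\{a+b: a\in A,\,b\in B\}$. Then almost surely $$\sigma(-\Delta)+\operatorname{supp}P_0\subseteq\sigma(H_\omega)\subseteq\sigma(-\Delta)+[\inf V_\omega,\sup V_\omega],$$ where $\inf V_\omega=\inf_{x\in\mathbb G}V_\omega(x)\in[-\infty,\infty)$, $\sup V_\omega=\sup_{x\in\mathbb G}V_\omega(x)\in(-\infty,\infty]$, and $[\inf V_\omega,\sup V_\omega]$ denotes the set of all real $t$ with $\inf V_\omega\le t\le\sup V_\omega$; and also almost surely $$\sigma(H_\omega)\subseteq[0,6]+\operatorname{supp}P_0 .$$ In particular, if $\operatorname{supp}P_0$ is an interval (bounded or unbounded), then almost surely the spectrum of $H_\omega$ is the deterministic set $$\sigma(H_\omega)=\sigma(-\Delta)+\operatorname{supp}P_0 .$$ -/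

import Mathlib

open MeasureTheory ProbabilityTheory
open scoped Pointwise ENNReal

noncomputable section

namespace SierpinskiAnderson

/-! ### The Sierpinski lattice

Points of the triangular lattice in the plane are written in integer coordinates with respect to the
basis `a₂ = (1, 0)`, `a₃ = (1/2, √3/2)`: the pair `(i, j)` stands for the point `i • a₂ + j • a₃`. -/

/-- The vertex set `{p + a₁, p + a₂, p + a₃}` of the translate by `p` of the unit triangle `T₀`,
where `a₁ = 0`. -/
def unitTriangle (p : ℤ × ℤ) : Set (ℤ × ℤ) := {p, p + (1, 0), p + (0, 1)}

/-- The lower left corners of the `3 ^ n` unit triangles which make up `T_n`, where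
`T_{n+1} = T_n ∪ (T_n + 2 ^ n a₂) ∪ (T_n + 2 ^ n a₃)`. -/
def corners : ℕ → Set (ℤ × ℤ)
  | 0 => {(0, 0)}
  | n + 1 => corners n ∪ (fun p => p + (2 ^ n, 0)) '' corners n
      ∪ (fun p => p + (0, 2 ^ n)) '' corners n

/-- The set `𝔾_n` of all vertices of the unit triangles of `T_n`. -/
def levelVertices (n : ℕ) : Set (ℤ × ℤ) := ⋃ p ∈ corners n, unitTriangle p

/-- The relation `ℰ_n`: the two points lie in a common unit triangle of `T_n`. -/
def levelEdge (n : ℕ) (x y : ℤ × ℤ) : Prop :=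
  ∃ p ∈ corners n, x ∈ unitTriangle p ∧ y ∈ unitTriangle p

/-- The reflection of the plane in the vertical axis. It maps `a₂` to `-a₂` and `a₃` to `a₃ - a₂`,
hence `i • a₂ + j • a₃` to `(-i - j) • a₂ + j • a₃`. -/
def reflect (x : ℤ × ℤ) : ℤ × ℤ := (-x.1 - x.2, x.2)

/-- The vertex set `𝔾 = ⋃ n, (𝔾_n ∪ 𝔾_n')` of the Sierpinski lattice. -/
def latticeVertices : Set (ℤ × ℤ) := ⋃ n, (levelVertices n ∪ reflect '' levelVertices n)

/-- The vertices of the Sierpinski lattice, as a type. -/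
abbrev Vertex : Type := latticeVertices

/-- The Sierpinski lattice: the edges are the pairs of distinct points in `⋃ n, (ℰ_n ∪ ℰ_n')`. -/
def lattice : SimpleGraph Vertex where
  Adj x y := x ≠ y ∧ ∃ n, levelEdge n x y ∨
    ∃ x' y', levelEdge n x' y' ∧ reflect x' = x ∧ reflect y' = y
  symm := by
    constructor
    rintro x y ⟨hne, n, ⟨p, hp, hx, hy⟩ | ⟨x', y', ⟨p, hp, hx, hy⟩, h1, h2⟩⟩
    · exact ⟨hne.symm, n, Or.inl ⟨p, hp, hy, hx⟩⟩
    · exact ⟨hne.symm, n, Or.inr ⟨y', x', ⟨p, hp, hy, hx⟩, h2, h1⟩⟩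
  loopless := by
    constructor
    intro x h
    exact h.1 rfl

theorem finite_neighborSet (x : Vertex) : (lattice.neighborSet x).Finite := by
  have hfin : (Set.Icc (x.1.1 - 2) (x.1.1 + 2) ×ˢ Set.Icc (x.1.2 - 2) (x.1.2 + 2)).Finite :=
    (Set.finite_Icc _ _).prod (Set.finite_Icc _ _)
  refine (hfin.preimage (Subtype.val_injective.injOn (s := Set.univ) |>.mono
    (Set.subset_univ _))).subset ?_
  rintro ⟨⟨y1, y2⟩, hy⟩ h
  obtain ⟨⟨x1, x2⟩, hx⟩ := x
  obtain ⟨-, n, h⟩ := h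
  rcases h with ⟨⟨p1, p2⟩, -, h1, h2⟩ | ⟨⟨u1, u2⟩, ⟨v1, v2⟩, ⟨⟨p1, p2⟩, -, h1, h2⟩, h3, h4⟩
  · simp only [unitTriangle, Set.mem_insert_iff, Set.mem_singleton_iff, Prod.mk_add_mk,
      Prod.mk.injEq] at h1 h2
    simp only [Set.mem_preimage, Set.mem_prod, Set.mem_Icc]
    omega
  · simp only [unitTriangle, Set.mem_insert_iff, Set.mem_singleton_iff, Prod.mk_add_mk,
      Prod.mk.injEq, reflect] at h1 h2 h3 h4
    simp only [Set.mem_preimage, Set.mem_prod, Set.mem_Icc]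
    omega

instance : lattice.LocallyFinite := fun x => (finite_neighborSet x).fintype

/-! ### The operators -/

/-- The graph Laplacian `Δ f (x) = ∑_{y ∼ x} (f y - f x)`, on all functions on the lattice. -/
def laplacian : (Vertex → ℂ) →ₗ[ℂ] (Vertex → ℂ) where
  toFun f x := ∑ y ∈ lattice.neighborFinset x, (f y - f x)
  map_add' f g := by
    funext x
    simp only [Pi.add_apply, ← Finset.sum_add_distrib]
    exact Finset.sum_congr rfl fun y _ => by ring
  map_smul' c f := by
    funext x
    simp only [Pi.smul_apply, smul_eq_mul, RingHom.id_apply, Finset.mul_sum]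
    exact Finset.sum_congr rfl fun y _ => by ring

/-- Multiplication by a real potential, on all functions on the lattice. -/
def potential (V : Vertex → ℝ) : (Vertex → ℂ) →ₗ[ℂ] (Vertex → ℂ) where
  toFun f x := (V x : ℂ) * f x
  map_add' f g := by
    funext x
    simp only [Pi.add_apply]
    ring
  map_smul' c f := by
    funext x
    simp only [Pi.smul_apply, smul_eq_mul, RingHom.id_apply]
    ring

/-- The Hilbert space `ℓ²(𝔾)` of complex-valued functions. -/
abbrev L2 : Type := lp (fun _ : Vertex => ℂ) 2

/-- The operator on `ℓ²(𝔾)` given by a linear operator `A` on functions, with its maximal domain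
`{f ∈ ℓ²(𝔾) | A f ∈ ℓ²(𝔾)}`. As `Δ` is bounded on `ℓ²(𝔾)`, this domain is the whole space for `-Δ`,
and it is the domain `{f | V f ∈ ℓ²(𝔾)}` of the multiplication operator for `-Δ + V`. -/
def onL2 (A : (Vertex → ℂ) →ₗ[ℂ] (Vertex → ℂ)) : L2 →ₗ.[ℂ] L2 where
  domain :=
    { carrier := {f | Memℓp (A (f : Vertex → ℂ)) 2}
      add_mem' := by
        intro f g hf hg
        simp only [Set.mem_ofPred_eq, lp.coeFn_add, map_add] at *
        exact Memℓp.add hf hg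
      zero_mem' := by
        simp only [Set.mem_ofPred_eq, lp.coeFn_zero, map_zero]
        exact zero_memℓp
      smul_mem' := by
        intro c f hf
        simp only [Set.mem_ofPred_eq, lp.coeFn_smul, map_smul] at *
        exact Memℓp.const_smul hf c }
  toFun :=
    { toFun := fun f => ⟨A ((f : L2) : Vertex → ℂ), f.2⟩
      map_add' := by
        intro f g
        apply Subtype.ext
        exact map_add A _ _
      map_smul' := by
        intro c f
        apply Subtype.ext
        exact map_smul A _ _ }

/-- The free operator `-Δ` on `ℓ²(𝔾)`. -/
def free : L2 →ₗ.[ℂ] L2 := onL2 (-laplacian)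

/-- The Schrödinger operator `-Δ + V` on `ℓ²(𝔾)`. -/
def hamiltonian (V : Vertex → ℝ) : L2 →ₗ.[ℂ] L2 := onL2 (-laplacian + potential V)

/-! ### Spectra of possibly unbounded operators -/

/-- The resolvent set of an operator `T` with domain: the `z` for which `T - z` maps the domain
of `T` bijectively onto the whole space, with a bounded inverse `R`. -/
def resolventSet {E : Type*} [NormedAddCommGroup E] [NormedSpace ℂ E] (T : E →ₗ.[ℂ] E) : Set ℂ :=
  {z | ∃ R : E →L[ℂ] E,
    (∀ g : E, ∃ h : R g ∈ T.domain, T ⟨R g, h⟩ - z • R g = g) ∧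
    ∀ f : T.domain, R (T f - z • (f : E)) = f}

/-- The spectrum of an operator with domain. -/
def opSpectrum {E : Type*} [NormedAddCommGroup E] [NormedSpace ℂ E] (T : E →ₗ.[ℂ] E) : Set ℂ :=
  (resolventSet T)ᶜ

/-- The closed interval `[inf V, sup V]` of real numbers, where `inf V` may be `-∞` and `sup V` may
be `+∞`. -/
def valueInterval (V : Vertex → ℝ) : Set ℝ :=
  {t | (⨅ x, (V x : EReal)) ≤ (t : EReal) ∧ (t : EReal) ≤ ⨆ x, (V x : EReal)}

end SierpinskiAnderson

end

/-! Every vertex lies in exactly two unit triangles, so `-Δ = 6 - S* S`, where `S` (`triangleOp`)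
sums a function over the unit triangles. Cauchy–Schwarz on the three vertices and double counting
give `‖S‖² ≤ 3 · 2`, hence `‖-Δ - 3‖ ≤ 3`; this is the source of `[0, 6]`. With its maximal domain,
`H = -Δ + V` behaves as a self-adjoint operator: a real `t` is in the resolvent set as soon as `H -
t` is bounded below (`mem_resolventSet_of_bound`).

Upper bounds: write `H - t` as a sum of two shifted summands, one bounded below by a distance and
the other of strictly smaller norm. For `[0, 6] + supp P₀` the small one is `-Δ - 3`; for `σ(-Δ) +
[inf V, sup V]` with bounded `V` it is `V - m`, with `m` the midpoint of the interval. If only one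
end is finite, quadratic forms are compared instead.

Lower bound: for `t ∈ σ(-Δ)` take a finitely supported approximate eigenfunction. Below height `2 ^
n` the lattice is invariant under horizontal translation by `2 ^ n`, so the function has infinitely
many disjoint translates that serve equally well (`exists_translate`). For `v ∈ supp P₀`, the second
Borel–Cantelli lemma yields a translate on which `V` is within `ε` of `v` (`ae_exists_window`), and
there `H` acts almost as `-Δ + v`.

The periodicity and the count of triangles are read off from binary digits: corners are the pairs
`(i, j)` without a common digit `1`, which makes every combinatorial claim an induction by halving.
-/

noncomputable section

namespace SierpinskiAnderson

/-! ### The unit triangles of the lattice -/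

/-- The lower left corners of all the unit triangles of the Sierpinski lattice: the pairs `(i, j)`
with `j ≥ 0` whose binary expansions (in two's complement) have no common digit `1`. -/
def allCorners : Set (ℤ × ℤ) := {p | 0 ≤ p.2 ∧ ∀ k : ℕ, ¬(Odd (p.1 / 2 ^ k) ∧ Odd (p.2 / 2 ^ k))}

/-- Separating the last binary digit from the others is the step of all the inductions below. -/
theorem mem_allCorners_iff_half (i j : ℤ) :
    (i, j) ∈ allCorners ↔ ¬(Odd i ∧ Odd j) ∧ (i / 2, j / 2) ∈ allCorners := by
  simp only [allCorners, Set.mem_ofPred_eq]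
  have hdiv : ∀ (a : ℤ) (k : ℕ), a / 2 / 2 ^ k = a / 2 ^ (k + 1) := by
    intro a k
    rw [pow_succ', Int.ediv_ediv_of_nonneg (by norm_num)]
  constructor
  · rintro ⟨h0, h⟩
    refine ⟨by simpa using h 0, by omega, fun k => ?_⟩
    rw [hdiv, hdiv]
    exact h (k + 1)
  · rintro ⟨h1, h0, h⟩
    refine ⟨by omega, fun k => ?_⟩
    cases k with
    | zero => simpa using h1
    | succ k => simpa only [hdiv] using h k

theorem mem_allCorners_zero (i : ℤ) : (i, 0) ∈ allCorners := by
  simp [allCorners]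

theorem allCorners_nonneg {i j : ℤ} (h : (i, j) ∈ allCorners) : 0 ≤ j := h.1

/-- Only the digits of `i` from position `n` on change, and a nonnegative `j` has no digit `1`
there. This is the horizontal periodicity of the lattice. -/
theorem mem_allCorners_add_mul (n : ℕ) : ∀ (i j m : ℤ), j < 2 ^ n →
    ((i + 2 ^ n * m, j) ∈ allCorners ↔ (i, j) ∈ allCorners) := by
  induction n with
  | zero =>
    intro i j m hj
    by_cases h0 : 0 ≤ j
    · obtain rfl : j = 0 := by simp at hj; omega
      simp [mem_allCorners_zero]
    · exact iff_of_false (fun h => h0 h.1) (fun h => h0 h.1)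
  | succ n ih =>
    intro i j m hj
    rw [mem_allCorners_iff_half, mem_allCorners_iff_half i]
    have e : (i + 2 ^ (n + 1) * m) = i + 2 * (2 ^ n * m) := by ring
    have hj' : j / 2 < 2 ^ n := by rw [pow_succ] at hj; omega
    rw [e, Int.add_mul_ediv_left _ _ (by norm_num), ih _ _ _ hj']
    have : Odd (i + 2 * (2 ^ n * m)) ↔ Odd i := by simp [parity_simps]
    rw [this]

/-- Adding `2 ^ n` sets the digit at position `n`, which is `0` in both numbers: harmless in one of
them, a clash in both. -/
theorem mem_allCorners_add_pow_snd (n : ℕ) : ∀ (i j : ℤ), 0 ≤ i → i < 2 ^ n → 0 ≤ j → j < 2 ^ n →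
    ((i, j + 2 ^ n) ∈ allCorners ↔ (i, j) ∈ allCorners) ∧ (i + 2 ^ n, j + 2 ^ n) ∉ allCorners := by
  induction n with
  | zero =>
    intro i j h1 h2 h3 h4
    obtain rfl : i = 0 := by simp at h2; omega
    obtain rfl : j = 0 := by simp at h4; omega
    refine ⟨iff_of_true ?_ (mem_allCorners_zero _), fun h => ?_⟩
    · rw [mem_allCorners_iff_half]
      exact ⟨by simp, mem_allCorners_zero _⟩
    · rw [mem_allCorners_iff_half] at h
      simp at h
  | succ n ih =>
    intro i j h1 h2 h3 h4
    rw [pow_succ] at h2 h4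
    obtain ⟨ih1, ih2⟩ := ih (i / 2) (j / 2) (by omega) (by omega) (by omega) (by omega)
    rw [mem_allCorners_iff_half, mem_allCorners_iff_half i j, mem_allCorners_iff_half (i + _)]
    have e : ∀ a : ℤ, (a + 2 ^ (n + 1)) = a + 2 * 2 ^ n := by intro a; ring
    rw [e, e, Int.add_mul_ediv_left _ _ (by norm_num), Int.add_mul_ediv_left _ _ (by norm_num), ih1]
    have : Odd (j + 2 * 2 ^ n) ↔ Odd j := by simp [parity_simps]
    rw [this]
    exact ⟨Iff.rfl, fun h => ih2 h.2⟩

theorem mem_corners_iff (n : ℕ) : ∀ i j : ℤ, (i, j) ∈ corners n ↔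
    (i, j) ∈ allCorners ∧ 0 ≤ i ∧ i < 2 ^ n ∧ j < 2 ^ n := by
  induction n with
  | zero =>
    intro i j
    simp only [corners, Set.mem_singleton_iff, Prod.mk.injEq, pow_zero]
    constructor
    · rintro ⟨rfl, rfl⟩
      exact ⟨mem_allCorners_zero _, by norm_num⟩
    · rintro ⟨h, h1, h2, h3⟩
      have := h.1
      simp only at this
      omega
  | succ n ih =>
    intro i j
    have hpos : (0 : ℤ) < 2 ^ n := by positivity
    simp only [corners, Set.mem_union, Set.mem_image, Prod.exists, ih, Prod.mk_add_mk,
      Prod.mk.injEq, add_zero]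
    rw [pow_succ]
    constructor
    · rintro ((h | ⟨a, b, ⟨hC, h1, h2, h3⟩, rfl, rfl⟩) | ⟨a, b, ⟨hC, h1, h2, h3⟩, rfl, rfl⟩)
      · exact ⟨h.1, by omega⟩
      · refine ⟨?_, by omega⟩
        simpa using (mem_allCorners_add_mul n a b 1 h3).2 hC
      · exact ⟨(mem_allCorners_add_pow_snd n a b h1 h2 hC.1 h3).1.2 hC, by omega⟩
    · rintro ⟨hC, h1, h2, h3⟩
      have h4 := allCorners_nonneg hC
      rcases lt_or_ge i (2 ^ n) with hi | hi <;> rcases lt_or_ge j (2 ^ n) with hj | hj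
      · exact Or.inl (Or.inl ⟨hC, h1, hi, hj⟩)
      · refine Or.inr ⟨i, j - 2 ^ n, ⟨?_, by omega⟩, rfl, by ring⟩
        have := (mem_allCorners_add_pow_snd n i (j - 2 ^ n) h1 hi (by omega) (by omega)).1
        rw [sub_add_cancel] at this
        exact this.1 hC
      · refine Or.inl (Or.inr ⟨i - 2 ^ n, j, ⟨?_, by omega⟩, by ring, rfl⟩)
        have := mem_allCorners_add_mul n (i - 2 ^ n) j 1 hj
        rw [mul_one, sub_add_cancel] at this
        exact this.1 hC
      · have := (mem_allCorners_add_pow_snd n (i - 2 ^ n) (j - 2 ^ n) (by omega) (by omega)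
          (by omega) (by omega)).2
        simp only [sub_add_cancel] at this
        exact absurd hC this

/-- The number `-i - 1` is the digitwise complement of `i`. The digits of `j` avoid those of `i`
exactly when they are among those of `-i - 1`; then `j` is subtracted without borrowing and the
difference avoids `j`. -/
theorem mem_allCorners_mirror (n : ℕ) : ∀ i j : ℤ, j < 2 ^ n → i < 0 →
    ((i, j) ∈ allCorners ↔ (-i - j - 1, j) ∈ allCorners ∧ 0 ≤ -i - j - 1) := by
  induction n with
  | zero =>
    intro i j hj hi
    by_cases h0 : 0 ≤ j
    · obtain rfl : j = 0 := by simp at hj; omega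
      simp only [mem_allCorners_zero, true_and, true_iff]
      omega
    · exact iff_of_false (fun h => h0 h.1) (fun h => h0 h.1.1)
  | succ n ih =>
    intro i j hj hi
    rw [pow_succ] at hj
    rw [mem_allCorners_iff_half, mem_allCorners_iff_half (-i - j - 1), ih _ _ (by omega) (by omega)]
    simp only [Int.odd_iff]
    by_cases hb : i % 2 = 1 ∧ j % 2 = 1
    · exact iff_of_false (fun h => h.1 hb) (fun h => h.1.1 (by omega))
    · have e : (-i - j - 1) / 2 = -(i / 2) - j / 2 - 1 := by omega
      rw [e]
      have : ¬((-i - j - 1) % 2 = 1 ∧ j % 2 = 1) := by omega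
      simp only [hb, this, not_false_eq_true, true_and]
      refine and_congr_right fun _ => ?_
      omega

/-- Two of the three unit triangles of the triangular lattice which contain a given point belong to
the Sierpinski lattice, or none does. -/
theorem allCorners_of_vertex (n : ℕ) : ∀ i j : ℤ, j < 2 ^ n →
    ((i, j) ∈ allCorners ∧ (i - 1, j) ∈ allCorners ∧ (i, j - 1) ∉ allCorners) ∨
    ((i, j) ∈ allCorners ∧ (i - 1, j) ∉ allCorners ∧ (i, j - 1) ∈ allCorners) ∨
    ((i, j) ∉ allCorners ∧ (i - 1, j) ∈ allCorners ∧ (i, j - 1) ∈ allCorners) ∨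
    ((i, j) ∉ allCorners ∧ (i - 1, j) ∉ allCorners ∧ (i, j - 1) ∉ allCorners) := by
  induction n with
  | zero =>
    intro i j hj
    by_cases h0 : 0 ≤ j
    · obtain rfl : j = 0 := by simp at hj; omega
      exact Or.inl ⟨mem_allCorners_zero _, mem_allCorners_zero _, fun h => by simpa using h.1⟩
    · refine Or.inr (Or.inr (Or.inr ⟨fun h => h0 h.1, fun h => h0 h.1, fun h => ?_⟩))
      have := allCorners_nonneg h
      omega
  | succ n ih =>
    intro i j hj
    rw [pow_succ] at hj
    rw [mem_allCorners_iff_half i j, mem_allCorners_iff_half (i - 1),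
      mem_allCorners_iff_half i (j - 1)]
    simp only [Int.odd_iff]
    rcases Int.emod_two_eq_zero_or_one i with hi | hi <;>
      rcases Int.emod_two_eq_zero_or_one j with hj' | hj'
    -- If both coordinates are even, halving gives the same configuration at `(i / 2, j / 2)`. For
    -- the other parities all three points have the same half, and parity excludes exactly one of
    -- them.
    · have := ih (i / 2) (j / 2) (by omega)
      rw [show (i - 1) / 2 = i / 2 - 1 by omega, show (j - 1) / 2 = j / 2 - 1 by omega]
      simp only [hi, hj']
      simpa using this
    · have : (i - 1) % 2 = 1 := by omega
      rw [show (j - 1) / 2 = j / 2 by omega]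
      simp only [hi, hj', this]
      simp
      tauto
    · have : (j - 1) % 2 = 1 := by omega
      rw [show (i - 1) / 2 = i / 2 by omega]
      simp only [hi, hj', this]
      simp
      tauto
    · have h1 : (j - 1) % 2 = 0 := by omega
      have h2 : (i - 1) % 2 = 0 := by omega
      rw [show (i - 1) / 2 = i / 2 by omega, show (j - 1) / 2 = j / 2 by omega]
      simp only [hi, hj', h1, h2]
      simp
      tauto

theorem exists_lt_two_pow (a b : ℤ) : ∃ n : ℕ, a < 2 ^ n ∧ b < 2 ^ n := by
  obtain ⟨n, hn⟩ := pow_unbounded_of_one_lt (max a b) (one_lt_two : (1 : ℤ) < 2)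
  exact ⟨n, lt_of_le_of_lt (le_max_left _ _) hn, lt_of_le_of_lt (le_max_right _ _) hn⟩

theorem mem_unitTriangle {x p : ℤ × ℤ} :
    x ∈ unitTriangle p ↔ p = x ∨ p = x - (1, 0) ∨ p = x - (0, 1) := by
  simp only [unitTriangle, Set.mem_insert_iff, Set.mem_singleton_iff, eq_sub_iff_add_eq]
  tauto

theorem reflect_mem_unitTriangle {i j : ℤ} {x : ℤ × ℤ} (hx : x ∈ unitTriangle (i, j)) :
    reflect x ∈ unitTriangle (-i - j - 1, j) := by
  obtain ⟨a, b⟩ := x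
  simp only [unitTriangle, Set.mem_insert_iff, Set.mem_singleton_iff, Prod.mk_add_mk,
      Prod.mk.injEq, reflect] at hx ⊢
  omega

theorem reflect_reflect (x : ℤ × ℤ) : reflect (reflect x) = x := by
  obtain ⟨a, b⟩ := x
  simp [reflect]

/-- The edge relation, together with the loops, in terms of `allCorners`. -/
theorem exists_levelEdge_iff (x y : ℤ × ℤ) :
    (∃ n, levelEdge n x y ∨ ∃ x' y', levelEdge n x' y' ∧ reflect x' = x ∧ reflect y' = y) ↔
      ∃ p ∈ allCorners, x ∈ unitTriangle p ∧ y ∈ unitTriangle p := by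
  constructor
  · rintro ⟨n, ⟨⟨i, j⟩, hp, hx, hy⟩ | ⟨x', y', ⟨⟨i, j⟩, hp, hx, hy⟩, rfl, rfl⟩⟩
    · exact ⟨(i, j), ((mem_corners_iff n i j).1 hp).1, hx, hy⟩
    · refine ⟨(-i - j - 1, j), ?_, reflect_mem_unitTriangle hx, reflect_mem_unitTriangle hy⟩
      obtain ⟨hC, h1, h2, h3⟩ := (mem_corners_iff n i j).1 hp
      have := allCorners_nonneg hC
      rw [mem_allCorners_mirror n _ _ h3 (by omega)]
      rw [show -(-i - j - 1) - j - 1 = i by ring]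
      exact ⟨hC, h1⟩
  · rintro ⟨⟨i, j⟩, hp, hx, hy⟩
    rcases le_or_gt 0 i with hi | hi
    · obtain ⟨n, h1, h2⟩ := exists_lt_two_pow i j
      exact ⟨n, Or.inl ⟨(i, j), (mem_corners_iff n i j).2 ⟨hp, hi, h1, h2⟩, hx, hy⟩⟩
    · obtain ⟨n, h1, h2⟩ := exists_lt_two_pow (-i - j - 1) j
      obtain ⟨hC, h3⟩ := (mem_allCorners_mirror n i j h2 hi).1 hp
      exact ⟨n, Or.inr ⟨reflect x, reflect y, ⟨_, (mem_corners_iff n _ j).2 ⟨hC, h3, h1, h2⟩,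
        reflect_mem_unitTriangle hx, reflect_mem_unitTriangle hy⟩, reflect_reflect _,
        reflect_reflect _⟩⟩

theorem mem_latticeVertices_iff (x : ℤ × ℤ) :
    x ∈ latticeVertices ↔ ∃ p ∈ allCorners, x ∈ unitTriangle p := by
  have := exists_levelEdge_iff x x
  simp only [and_self] at this
  rw [← this]
  simp only [latticeVertices, Set.mem_iUnion, Set.mem_union, levelVertices, levelEdge,
    Set.mem_image, and_self, exists_prop]
  refine exists_congr fun n => or_congr Iff.rfl ⟨?_, ?_⟩
  · rintro ⟨x', ⟨p, hp, hx⟩, h⟩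
    exact ⟨x', x', ⟨p, hp, hx, hx⟩, h, h⟩
  · rintro ⟨x', y', ⟨p, hp, hx, -⟩, h, -⟩
    exact ⟨x', ⟨p, hp, hx⟩, h⟩

theorem mem_latticeVertices_iff' (x : ℤ × ℤ) : x ∈ latticeVertices ↔
    x ∈ allCorners ∨ x - (1, 0) ∈ allCorners ∨ x - (0, 1) ∈ allCorners := by
  rw [mem_latticeVertices_iff]
  simp only [mem_unitTriangle]
  constructor
  · rintro ⟨p, hp, rfl | rfl | rfl⟩ <;> tauto
  · rintro (h | h | h)
    exacts [⟨_, h, Or.inl rfl⟩, ⟨_, h, Or.inr (Or.inl rfl)⟩, ⟨_, h, Or.inr (Or.inr rfl)⟩]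

theorem lattice_adj_iff (x y : Vertex) : lattice.Adj x y ↔
    x ≠ y ∧ ∃ p ∈ allCorners, (x : ℤ × ℤ) ∈ unitTriangle p ∧ (y : ℤ × ℤ) ∈ unitTriangle p :=
  and_congr_right fun _ => exists_levelEdge_iff x y

theorem mem_latticeVertices_of_corner {p : ℤ × ℤ} (hp : p ∈ allCorners) :
    p ∈ latticeVertices ∧ p + (1, 0) ∈ latticeVertices ∧ p + (0, 1) ∈ latticeVertices := by
  refine ⟨?_, ?_, ?_⟩ <;> rw [mem_latticeVertices_iff] <;>
    exact ⟨p, hp, by simp [unitTriangle]⟩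

/-- Translations by `(2 ^ n * m, 0)` preserve the part of the lattice below the height `2 ^ n`. -/
theorem allCorners_translate (n : ℕ) (m : ℤ) (x : ℤ × ℤ) (hx : x.2 < 2 ^ n) :
    x - (2 ^ n * m, 0) ∈ allCorners ↔ x ∈ allCorners := by
  obtain ⟨i, j⟩ := x
  have := mem_allCorners_add_mul n i j (-m) hx
  simpa [sub_eq_add_neg] using this

theorem latticeVertices_translate (n : ℕ) (m : ℤ) (x : ℤ × ℤ) (hx : x.2 < 2 ^ n) :
    x - (2 ^ n * m, 0) ∈ latticeVertices ↔ x ∈ latticeVertices := by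
  rw [mem_latticeVertices_iff', mem_latticeVertices_iff', sub_right_comm, sub_right_comm _ _ (0, 1),
    allCorners_translate n m x hx, allCorners_translate n m _ (by simpa using hx),
    allCorners_translate n m _ (by simp; omega)]

end SierpinskiAnderson

namespace SierpinskiAnderson

/-! ### The Laplacian in terms of the unit triangles -/

open Classical in
/-- The extension by zero of a function on the Sierpinski lattice to the triangular lattice. -/
def zeroExtend (f : Vertex → ℂ) (x : ℤ × ℤ) : ℂ := if h : x ∈ latticeVertices then f ⟨x, h⟩ else 0

theorem zeroExtend_coe (f : Vertex → ℂ) (x : Vertex) : zeroExtend f x = f x := by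
  simp [zeroExtend]

theorem zeroExtend_of_notMem (f : Vertex → ℂ) {x : ℤ × ℤ} (hx : x ∉ latticeVertices) :
    zeroExtend f x = 0 := by
  simp [zeroExtend, hx]

theorem zeroExtend_add (f g : Vertex → ℂ) (x : ℤ × ℤ) :
    zeroExtend (f + g) x = zeroExtend f x + zeroExtend g x := by
  by_cases h : x ∈ latticeVertices <;> simp [zeroExtend, h]

theorem zeroExtend_smul (c : ℂ) (f : Vertex → ℂ) (x : ℤ × ℤ) :
    zeroExtend (c • f) x = c * zeroExtend f x := by
  by_cases h : x ∈ latticeVertices <;> simp [zeroExtend, h]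

/-- The sum of a function over the vertices of the unit triangle with lower left corner `p`, if this
triangle belongs to the Sierpinski lattice. -/
def triangleSum (F : ℤ × ℤ → ℂ) : ℤ × ℤ → ℂ :=
  allCorners.indicator fun p => F p + F (p + (1, 0)) + F (p + (0, 1))

theorem triangleSum_of_mem (F : ℤ × ℤ → ℂ) {p : ℤ × ℤ} (hp : p ∈ allCorners) :
    triangleSum F p = F p + F (p + (1, 0)) + F (p + (0, 1)) := by
  simp [triangleSum, hp]

theorem triangleSum_of_notMem (F : ℤ × ℤ → ℂ) {p : ℤ × ℤ} (hp : p ∉ allCorners) :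
    triangleSum F p = 0 := by
  simp [triangleSum, hp]

theorem allCorners_cases {x : ℤ × ℤ} (hx : x ∈ latticeVertices) :
    (x ∈ allCorners ∧ x - (1, 0) ∈ allCorners ∧ x - (0, 1) ∉ allCorners) ∨
    (x ∈ allCorners ∧ x - (1, 0) ∉ allCorners ∧ x - (0, 1) ∈ allCorners) ∨
    (x ∉ allCorners ∧ x - (1, 0) ∈ allCorners ∧ x - (0, 1) ∈ allCorners) := by
  obtain ⟨i, j⟩ := x
  obtain ⟨n, hn, -⟩ := exists_lt_two_pow j 0
  have h1 := allCorners_of_vertex n i j hn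
  have h2 := (mem_latticeVertices_iff' _).1 hx
  simp only [Prod.mk_sub_mk, sub_zero] at h2 ⊢
  tauto

/-- In plain integer coordinates the four neighbours can be listed explicitly. -/
theorem mem_map_neighborFinset (x : Vertex) (y : ℤ × ℤ) :
    y ∈ (lattice.neighborFinset x).map (Function.Embedding.subtype _) ↔
      (x : ℤ × ℤ) ≠ y ∧ ((x : ℤ × ℤ) ∈ allCorners ∧ y ∈ unitTriangle x ∨
        (x : ℤ × ℤ) - (1, 0) ∈ allCorners ∧ y ∈ unitTriangle ((x : ℤ × ℤ) - (1, 0)) ∨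
        (x : ℤ × ℤ) - (0, 1) ∈ allCorners ∧ y ∈ unitTriangle ((x : ℤ × ℤ) - (0, 1))) := by
  simp only [Finset.mem_map, SimpleGraph.mem_neighborFinset, lattice_adj_iff,
    mem_unitTriangle (x := (x : ℤ × ℤ)), Function.Embedding.subtype_apply]
  constructor
  · rintro ⟨y, ⟨hne, p, hp, rfl | rfl | rfl, hy⟩, rfl⟩
    all_goals refine ⟨fun h => hne (Subtype.ext h), ?_⟩
    exacts [Or.inl ⟨hp, hy⟩, Or.inr (Or.inl ⟨hp, hy⟩), Or.inr (Or.inr ⟨hp, hy⟩)]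
  · rintro ⟨hne, ⟨hp, hy⟩ | ⟨hp, hy⟩ | ⟨hp, hy⟩⟩
    all_goals
      refine ⟨⟨y, (mem_latticeVertices_iff y).2 ⟨_, hp, hy⟩⟩,
        ⟨fun h => hne (congrArg Subtype.val h), _, hp, ?_, hy⟩, rfl⟩
      simp

/-- The two triangles at `x` together count `f x` twice and each of the four neighbours once, so `4
f x` minus the neighbours is `6 f x` minus the two triangle sums. The third triangle contributes
`0`. -/
theorem neg_laplacian_apply (f : Vertex → ℂ) (x : Vertex) :
    (-laplacian) f x = 6 * f x - (triangleSum (zeroExtend f) x +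
      triangleSum (zeroExtend f) ((x : ℤ × ℤ) - (1, 0)) + triangleSum (zeroExtend f) ((x : ℤ × ℤ) - (0, 1))) := by
  have hsum : laplacian f x = ∑ y ∈ (lattice.neighborFinset x).map (Function.Embedding.subtype _),
      (zeroExtend f y - f x) := by
    rw [Finset.sum_map]
    exact Finset.sum_congr rfl fun y _ => by rw [Function.Embedding.subtype_apply, zeroExtend_coe]
  rw [LinearMap.neg_apply, Pi.neg_apply, hsum]
  have hx := zeroExtend_coe f x
  have hmem := mem_map_neighborFinset x
  obtain ⟨⟨i, j⟩, hv⟩ := x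
  simp only at *
  set v : Vertex := ⟨(i, j), hv⟩
  rcases allCorners_cases hv with ⟨h1, h2, h3⟩ | ⟨h1, h2, h3⟩ | ⟨h1, h2, h3⟩
  · have e : (lattice.neighborFinset v).map (Function.Embedding.subtype _) =
        {(i + 1, j), (i, j + 1), (i - 1, j), (i - 1, j + 1)} := by
      ext ⟨a, b⟩
      rw [hmem]
      simp only [h1, h2, h3, true_and, false_and, or_false]
      simp only [unitTriangle, Set.mem_insert_iff, Set.mem_singleton_iff, Finset.mem_insert,
        Finset.mem_singleton, Prod.mk_add_mk, Prod.mk_sub_mk, Prod.mk.injEq, ne_eq]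
      omega
    rw [e, triangleSum_of_mem _ h1, triangleSum_of_mem _ h2, triangleSum_of_notMem _ h3,
      Finset.sum_insert (by simp; omega), Finset.sum_insert (by simp; omega),
      Finset.sum_insert (by simp), Finset.sum_singleton, ← hx]
    simp only [Prod.mk_add_mk, Prod.mk_sub_mk, add_zero, sub_zero, sub_add_cancel]
    ring
  · have e : (lattice.neighborFinset v).map (Function.Embedding.subtype _) =
        {(i + 1, j), (i, j + 1), (i, j - 1), (i + 1, j - 1)} := by
      ext ⟨a, b⟩
      rw [hmem]
      simp only [h1, h2, h3, true_and, false_and, false_or]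
      simp only [unitTriangle, Set.mem_insert_iff, Set.mem_singleton_iff, Finset.mem_insert,
        Finset.mem_singleton, Prod.mk_add_mk, Prod.mk_sub_mk, Prod.mk.injEq, ne_eq]
      omega
    rw [e, triangleSum_of_mem _ h1, triangleSum_of_mem _ h3, triangleSum_of_notMem _ h2,
      Finset.sum_insert (by simp; omega), Finset.sum_insert (by simp; omega),
      Finset.sum_insert (by simp), Finset.sum_singleton, ← hx]
    simp only [Prod.mk_add_mk, Prod.mk_sub_mk, add_zero, sub_zero, sub_add_cancel]
    ring
  · have e : (lattice.neighborFinset v).map (Function.Embedding.subtype _) =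
        {(i - 1, j), (i - 1, j + 1), (i, j - 1), (i + 1, j - 1)} := by
      ext ⟨a, b⟩
      rw [hmem]
      simp only [h1, h2, h3, true_and, false_and, false_or]
      simp only [unitTriangle, Set.mem_insert_iff, Set.mem_singleton_iff, Finset.mem_insert,
        Finset.mem_singleton, Prod.mk_add_mk, Prod.mk_sub_mk, Prod.mk.injEq, ne_eq]
      omega
    rw [e, triangleSum_of_mem _ h2, triangleSum_of_mem _ h3, triangleSum_of_notMem _ h1,
      Finset.sum_insert (by simp; omega), Finset.sum_insert (by simp; omega),
      Finset.sum_insert (by simp), Finset.sum_singleton, ← hx]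
    simp only [Prod.mk_add_mk, Prod.mk_sub_mk, add_zero, sub_zero, zero_add, sub_add_cancel]
    ring

end SierpinskiAnderson

namespace SierpinskiAnderson

/-! ### The Laplacian as a bounded operator -/

theorem hasSum_norm_sq {ι : Type*} (f : lp (fun _ : ι => ℂ) 2) :
    HasSum (fun i => ‖f i‖ ^ 2) (‖f‖ ^ 2) := by
  simpa using lp.hasSum_norm (p := 2) (by norm_num) f

theorem memℓp_two_iff {ι : Type*} (f : ι → ℂ) : Memℓp f 2 ↔ Summable fun i => ‖f i‖ ^ 2 := by
  simpa using memℓp_gen_iff (p := 2) (by norm_num) (f := f)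

theorem hasSum_norm_sq_zeroExtend (f : L2) :
    HasSum (fun p => ‖zeroExtend f p‖ ^ 2) (‖f‖ ^ 2) := by
  have h := hasSum_norm_sq f
  rw [← hasSum_subtype_iff_of_support_subset (s := latticeVertices)]
  · convert h using 3 with x
    simp [zeroExtend_coe]
  · intro p hp
    by_contra hmem
    exact hp (by simp [zeroExtend_of_notMem _ hmem])

/-- Every vertex of the Sierpinski lattice belongs to exactly two unit triangles. -/
theorem hasSum_indicator_allCorners {u : ℤ × ℤ → ℝ} {s : ℝ} (hu : HasSum u s)
    (h0 : ∀ p ∉ latticeVertices, u p = 0) :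
    HasSum (allCorners.indicator fun p => u p + u (p + (1, 0)) + u (p + (0, 1))) (2 * s) := by
  -- Double counting, one vertex position `v` at a time: summing over triangles equals summing over
  -- the points that occupy this position in some triangle.
  have key : ∀ v : ℤ × ℤ, ∃ S : ℝ, HasSum ({q | q - v ∈ allCorners}.indicator u) S ∧
      HasSum (allCorners.indicator fun p => u (p + v)) S := by
    intro v
    obtain ⟨S, hS⟩ := hu.summable.indicator {q | q - v ∈ allCorners}
    refine ⟨S, hS, ?_⟩
    rw [← (Equiv.addRight v).hasSum_iff] at hS
    exact hS.congr_fun fun p => by by_cases hp : p ∈ allCorners <;> simp [hp]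
  obtain ⟨S0, h1, h2⟩ := key 0
  obtain ⟨S1, h3, h4⟩ := key (1, 0)
  obtain ⟨S2, h5, h6⟩ := key (0, 1)
  have e : S0 + S1 + S2 = 2 * s := by
    refine ((h1.add h3).add h5).unique ?_
    refine (hu.mul_left 2).congr_fun fun p => ?_
    by_cases hp : p ∈ latticeVertices
    · rcases allCorners_cases hp with ⟨a, b, c⟩ | ⟨a, b, c⟩ | ⟨a, b, c⟩ <;>
        simp [Set.indicator, a, b, c] <;> ring
    · simp [Set.indicator, h0 p hp]
  rw [← e]
  refine ((h2.add h4).add h6).congr_fun fun p => ?_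
  by_cases hp : p ∈ allCorners <;> simp [hp]

theorem norm_sq_triangleSum_le (F : ℤ × ℤ → ℂ) (p : ℤ × ℤ) :
    ‖triangleSum F p‖ ^ 2 ≤ 3 * (allCorners.indicator
      (fun p => ‖F p‖ ^ 2 + ‖F (p + (1, 0))‖ ^ 2 + ‖F (p + (0, 1))‖ ^ 2) p) := by
  by_cases hp : p ∈ allCorners
  · rw [triangleSum_of_mem _ hp, Set.indicator_of_mem hp]
    have h := norm_add₃_le (a := F p) (b := F (p + (1, 0))) (c := F (p + (0, 1)))
    have h0 := norm_nonneg (F p + F (p + (1, 0)) + F (p + (0, 1)))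
    nlinarith [sq_nonneg (‖F p‖ - ‖F (p + (1, 0))‖), sq_nonneg (‖F p‖ - ‖F (p + (0, 1))‖),
      sq_nonneg (‖F (p + (1, 0))‖ - ‖F (p + (0, 1))‖)]
  · simp [triangleSum_of_notMem _ hp, hp]

theorem hasSum_triangle_norm_sq (f : L2) : HasSum (fun p => 3 * (allCorners.indicator
      (fun p => ‖zeroExtend f p‖ ^ 2 + ‖zeroExtend f (p + (1, 0))‖ ^ 2 +
        ‖zeroExtend f (p + (0, 1))‖ ^ 2) p)) (6 * ‖f‖ ^ 2) := by
  have h := (hasSum_indicator_allCorners (hasSum_norm_sq_zeroExtend f) fun p hp => by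
    simp [zeroExtend_of_notMem _ hp]).mul_left 3
  rwa [← mul_assoc, show (3 : ℝ) * 2 = 6 by norm_num] at h

theorem memℓp_triangleSum (f : L2) : Memℓp (triangleSum (zeroExtend f)) 2 := by
  rw [memℓp_two_iff]
  exact Summable.of_nonneg_of_le (fun _ => by positivity) (norm_sq_triangleSum_le _)
    (hasSum_triangle_norm_sq f).summable

theorem triangleSum_add (F G : ℤ × ℤ → ℂ) : triangleSum (F + G) = triangleSum F + triangleSum G := by
  rw [triangleSum, triangleSum, triangleSum, ← Set.indicator_add']
  congr 1
  funext p
  simp only [Pi.add_apply]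
  ring

theorem triangleSum_smul (c : ℂ) (F : ℤ × ℤ → ℂ) : triangleSum (c • F) = c • triangleSum F := by
  funext p
  by_cases hp : p ∈ allCorners
  · simp [triangleSum_of_mem _ hp, mul_add]
  · simp [triangleSum_of_notMem _ hp]

/-- The linear map which sums a function on the lattice over the unit triangles. -/
def triangleLinearMap : L2 →ₗ[ℂ] lp (fun _ : ℤ × ℤ => ℂ) 2 where
  toFun f := ⟨triangleSum (zeroExtend f), memℓp_triangleSum f⟩
  map_add' f g := by
    apply Subtype.ext
    have : zeroExtend ⇑(f + g) = zeroExtend f + zeroExtend g := funext (zeroExtend_add f g)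
    exact (congrArg triangleSum this).trans (triangleSum_add _ _)
  map_smul' c f := by
    apply Subtype.ext
    have : zeroExtend ⇑(c • f) = c • zeroExtend f := funext (zeroExtend_smul c f)
    exact (congrArg triangleSum this).trans (triangleSum_smul _ _)

theorem norm_triangleLinearMap_le (f : L2) : ‖triangleLinearMap f‖ ≤ √6 * ‖f‖ := by
  refine (sq_le_sq₀ (norm_nonneg _) (by positivity)).1 ?_
  rw [mul_pow, Real.sq_sqrt (by norm_num)]
  exact hasSum_le (norm_sq_triangleSum_le _) (hasSum_norm_sq (triangleLinearMap f))
    (hasSum_triangle_norm_sq f)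

/-- The operator which sums a function on the lattice over the unit triangles. -/
def triangleOp : L2 →L[ℂ] lp (fun _ : ℤ × ℤ => ℂ) 2 :=
  triangleLinearMap.mkContinuous (√6) norm_triangleLinearMap_le

theorem triangleOp_apply (f : L2) (p : ℤ × ℤ) :
    triangleOp f p = triangleSum (zeroExtend f) p := rfl

theorem norm_triangleOp_le : ‖triangleOp‖ ≤ √6 :=
  LinearMap.mkContinuous_norm_le _ (by positivity) _

-- This determines the adjoint, since `⟨δ_x, S* g⟩ = ⟨S δ_x, g⟩`.
open Classical in
theorem triangleOp_single (x : Vertex) : triangleOp (lp.single 2 x 1) =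
    lp.single 2 (x : ℤ × ℤ) (allCorners.indicator 1 (x : ℤ × ℤ)) +
    lp.single 2 ((x : ℤ × ℤ) - (1, 0)) (allCorners.indicator 1 ((x : ℤ × ℤ) - (1, 0))) +
    lp.single 2 ((x : ℤ × ℤ) - (0, 1)) (allCorners.indicator 1 ((x : ℤ × ℤ) - (0, 1))) := by
  have h : ∀ q : ℤ × ℤ, zeroExtend (Pi.single x (1 : ℂ)) q = if q = x then 1 else 0 := by
    intro q
    by_cases hq : q ∈ latticeVertices
    · rw [zeroExtend, dif_pos hq, Pi.single_apply]
      simp only [Subtype.ext_iff]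
    · rw [zeroExtend_of_notMem _ hq, if_neg]
      rintro rfl
      exact hq x.2
  refine lp.ext (funext fun p => ?_)
  simp only [triangleOp_apply, lp.coeFn_add, Pi.add_apply, lp.coeFn_single, Pi.single_apply,
    triangleSum]
  by_cases hp : p ∈ allCorners
  · rw [Set.indicator_of_mem hp]
    simp only [h, eq_sub_iff_add_eq]
    congr 1
    · congr 1
      · split_ifs with h1
        · simp [← h1, hp]
        · rfl
      · split_ifs with h1
        · simp [← h1, hp]
        · rfl
    · split_ifs with h1
      · simp [← h1, hp]
      · rfl
  · rw [Set.indicator_of_notMem hp]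
    have : ∀ q : ℤ × ℤ, (if p = q then allCorners.indicator 1 q else 0 : ℂ) = 0 := by
      intro q
      split_ifs with h1
      · simp [← h1, hp]
      · rfl
    simp [this]

/-- The operator `-Δ` on `ℓ²(𝔾)`. -/
def freeOp : L2 →L[ℂ] L2 := (6 : ℂ) • 1 - triangleOp.adjoint ∘L triangleOp

theorem freeOp_apply (f : L2) (x : Vertex) : freeOp f x = (-laplacian) f x := by
  classical
  have h1 : (triangleOp.adjoint (triangleOp f)) x = triangleSum (zeroExtend f) x +
      triangleSum (zeroExtend f) ((x : ℤ × ℤ) - (1, 0)) +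
      triangleSum (zeroExtend f) ((x : ℤ × ℤ) - (0, 1)) := by
    have h2 : inner ℂ (lp.single 2 x (1 : ℂ) : L2) (triangleOp.adjoint (triangleOp f)) =
        (triangleOp.adjoint (triangleOp f)) x := by
      rw [lp.inner_single_left]
      simp
    have h3 : ∀ q : ℤ × ℤ, inner ℂ (lp.single 2 q (allCorners.indicator 1 q) :
        lp (fun _ : ℤ × ℤ => ℂ) 2) (triangleOp f) = triangleSum (zeroExtend f) q := by
      intro q
      rw [lp.inner_single_left, triangleOp_apply]
      by_cases hq : q ∈ allCorners
      · simp [hq]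
      · simp [hq, triangleSum_of_notMem]
    rw [← h2, ContinuousLinearMap.adjoint_inner_right, triangleOp_single, inner_add_left,
      inner_add_left, h3, h3, h3]
  rw [neg_laplacian_apply, ← h1]
  rfl

theorem isSelfAdjoint_freeOp : IsSelfAdjoint freeOp := by
  refine IsSelfAdjoint.sub ?_ ?_
  · rw [isSelfAdjoint_iff, star_smul, star_one]
    simp
  · rw [ContinuousLinearMap.isSelfAdjoint_iff', ContinuousLinearMap.adjoint_comp,
      ContinuousLinearMap.adjoint_adjoint]

/-- Here `-Δ - 3 = 3 - S* S`, and `‖3 f - S* S f‖² = 9 ‖f‖² - 6 ‖S f‖² + ‖S* S f‖²`, where the last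
term is at most `6 ‖S f‖²`. -/
theorem norm_freeOp_sub_le (f : L2) : ‖freeOp f - (3 : ℂ) • f‖ ≤ 3 * ‖f‖ := by
  set g := triangleOp.adjoint (triangleOp f) with hg
  have e : freeOp f - (3 : ℂ) • f = (3 : ℂ) • f - g := by
    have : freeOp f = (6 : ℂ) • f - g := rfl
    rw [this, show (6 : ℂ) = 3 + 3 by norm_num, add_smul]
    abel
  have h1 : RCLike.re (inner ℂ f g) = ‖triangleOp f‖ ^ 2 := by
    rw [hg, ContinuousLinearMap.adjoint_inner_right, inner_self_eq_norm_sq]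
  have h2 : ‖g‖ ^ 2 ≤ 6 * ‖triangleOp f‖ ^ 2 := by
    have : ‖g‖ ≤ √6 * ‖triangleOp f‖ := by
      refine (ContinuousLinearMap.le_opNorm _ _).trans ?_
      rw [LinearIsometryEquiv.norm_map]
      gcongr
      exact norm_triangleOp_le
    calc ‖g‖ ^ 2 ≤ (√6 * ‖triangleOp f‖) ^ 2 := by gcongr
      _ = _ := by rw [mul_pow, Real.sq_sqrt (by norm_num)]
  refine (sq_le_sq₀ (norm_nonneg _) (by positivity)).1 ?_
  rw [e, @norm_sub_sq ℂ, inner_smul_left, norm_smul]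
  have h3 : RCLike.re ((starRingEnd ℂ) 3 * inner ℂ f g) = 3 * ‖triangleOp f‖ ^ 2 := by
    rw [← h1]
    simp
  rw [h3]
  simp only [Complex.norm_ofNat]
  nlinarith

end SierpinskiAnderson

namespace SierpinskiAnderson

/-! ### Bounded self-adjoint operators -/

section SelfAdjoint

variable {E : Type*} [NormedAddCommGroup E] [InnerProductSpace ℂ E] [CompleteSpace E]

/-- The functional calculus enters only here; the polynomials `X - c`, `c - X` and `(X - w)² - d²`
give the three spectral bounds below. -/
theorem re_inner_aeval_nonneg {A : E →L[ℂ] E} (hA : IsSelfAdjoint A) (q : Polynomial ℝ)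
    (hq : ∀ t ∈ spectrum ℝ A, 0 ≤ q.eval t) (f : E) :
    0 ≤ RCLike.re (inner ℂ f ((Polynomial.aeval A q) f)) := by
  have h : 0 ≤ Polynomial.aeval A q := by
    rw [← cfc_polynomial q A hA]
    exact cfc_nonneg hq
  exact ((ContinuousLinearMap.nonneg_iff_isPositive _).1 h).re_inner_nonneg_right f

theorem inner_self_re_eq {E : Type*} [NormedAddCommGroup E] [InnerProductSpace ℂ E] (f : E) : RCLike.re (inner ℂ f f) = ‖f‖ ^ 2 := inner_self_eq_norm_sq f

theorem le_re_inner_of_spectrum {A : E →L[ℂ] E} (hA : IsSelfAdjoint A) {c : ℝ}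
    (hc : ∀ t ∈ spectrum ℝ A, c ≤ t) (f : E) :
    c * ‖f‖ ^ 2 ≤ RCLike.re (inner ℂ f (A f)) := by
  have h := re_inner_aeval_nonneg hA (Polynomial.X - Polynomial.C c)
    (fun t ht => by simpa using hc t ht) f
  have e : (Polynomial.aeval A (Polynomial.X - Polynomial.C c)) f = A f - (c : ℂ) • f := by
    simp [Algebra.algebraMap_eq_smul_one]
  rw [e, inner_sub_right, inner_smul_right, map_sub] at h
  rw [← inner_self_re_eq]
  simpa using h

theorem re_inner_le_of_spectrum {A : E →L[ℂ] E} (hA : IsSelfAdjoint A) {c : ℝ}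
    (hc : ∀ t ∈ spectrum ℝ A, t ≤ c) (f : E) :
    RCLike.re (inner ℂ f (A f)) ≤ c * ‖f‖ ^ 2 := by
  have h := re_inner_aeval_nonneg hA (Polynomial.C c - Polynomial.X)
    (fun t ht => by simpa using hc t ht) f
  have e : (Polynomial.aeval A (Polynomial.C c - Polynomial.X)) f = (c : ℂ) • f - A f := by
    simp [Algebra.algebraMap_eq_smul_one]
  rw [e, inner_sub_right, inner_smul_right, map_sub] at h
  rw [← inner_self_re_eq]
  simpa using h

theorem inner_map_comm {A : E →L[ℂ] E} (hA : IsSelfAdjoint A) (f g : E) :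
    inner ℂ (A f) g = inner ℂ f (A g) :=
  (ContinuousLinearMap.isSelfAdjoint_iff_isSymmetric.1 hA) f g

theorem im_inner_map_self {A : E →L[ℂ] E} (hA : IsSelfAdjoint A) (f : E) :
    (inner ℂ f (A f)).im = 0 := by
  have h := inner_conj_symm (𝕜 := ℂ) f (A f)
  rw [inner_map_comm hA] at h
  exact Complex.conj_eq_iff_im.1 h

/-- The distance of `w` to the spectrum bounds `A - w` from below. -/
theorem le_norm_sub_smul_of_spectrum {A : E →L[ℂ] E} (hA : IsSelfAdjoint A) {w d : ℝ} (hd : 0 ≤ d)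
    (h : ∀ t ∈ spectrum ℝ A, d ≤ |t - w|) (f : E) : d * ‖f‖ ≤ ‖A f - (w : ℂ) • f‖ := by
  have h := re_inner_aeval_nonneg hA ((Polynomial.X - Polynomial.C w) ^ 2 - Polynomial.C (d ^ 2))
    (fun t ht => by simpa using sq_le_sq.2 (by rw [abs_of_nonneg hd]; exact h t ht)) f
  have hB : IsSelfAdjoint (A - (w : ℂ) • (1 : E →L[ℂ] E)) := by
    refine hA.sub ?_
    rw [isSelfAdjoint_iff, star_smul, star_one]
    simp
  set B := A - (w : ℂ) • (1 : E →L[ℂ] E) with hBdef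
  have e : (Polynomial.aeval A ((Polynomial.X - Polynomial.C w) ^ 2 - Polynomial.C (d ^ 2))) f =
      B (B f) - ((d ^ 2 : ℝ) : ℂ) • f := by
    have : Polynomial.aeval A (Polynomial.X - Polynomial.C w) = B := by
      ext g
      simp [hBdef, Algebra.algebraMap_eq_smul_one]
    rw [map_sub, map_pow, this, pow_two, Polynomial.aeval_C, Algebra.algebraMap_eq_smul_one]
    rfl
  rw [e, inner_sub_right, inner_smul_right, map_sub, ← inner_map_comm hB, inner_self_re_eq] at h
  have h2 : RCLike.re (((d ^ 2 : ℝ) : ℂ) * inner ℂ f f) = d ^ 2 * ‖f‖ ^ 2 := by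
    rw [← inner_self_re_eq]
    exact Complex.re_ofReal_mul _ _
  rw [h2] at h
  have h3 : B f = A f - (w : ℂ) • f := by simp [hBdef]
  rw [← h3]
  refine (sq_le_sq₀ (by positivity) (norm_nonneg _)).1 ?_
  rw [mul_pow]
  linarith

theorem spectrum_real_nonempty [Nontrivial E] {A : E →L[ℂ] E} (hA : IsSelfAdjoint A) :
    (spectrum ℝ A).Nonempty :=
  ContinuousFunctionalCalculus.spectrum_nonempty A hA

end SelfAdjoint

/-! ### The domain and the symmetry of the Hamiltonian -/

variable {V : Vertex → ℝ}

theorem hamiltonian_apply (f : (hamiltonian V).domain) (x : Vertex) :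
    hamiltonian V f x = freeOp f x + V x * (f : L2) x := by
  rw [freeOp_apply]
  rfl

/-- Since the domain is maximal, a pointwise identity with an `ℓ²` right-hand side already puts `f`
in it. -/
theorem mem_domain_hamiltonian {f g : L2} (h : ∀ x, g x = freeOp f x + V x * f x) :
    ∃ hf : f ∈ (hamiltonian V).domain, hamiltonian V ⟨f, hf⟩ = g := by
  have e : (-laplacian + potential V) f = g := by
    funext x
    rw [h, freeOp_apply]
    rfl
  have hf : Memℓp ((-laplacian + potential V) f) 2 := e ▸ lp.memℓp g
  exact ⟨hf, lp.ext e⟩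

theorem free_eq_hamiltonian : free = hamiltonian 0 := by
  have : potential 0 = 0 := by
    ext f x
    simp [potential]
  rw [free, hamiltonian, this, add_zero]

theorem mem_domain_free (f : L2) : ∃ hf : f ∈ free.domain, free ⟨f, hf⟩ = freeOp f := by
  rw [free_eq_hamiltonian]
  exact mem_domain_hamiltonian fun x => by simp

/-- The summand `V f` of `(-Δ + V) f`, as an element of `ℓ²(𝔾)`. -/
def potentialPart (f : (hamiltonian V).domain) : L2 := hamiltonian V f - freeOp f

theorem potentialPart_apply (f : (hamiltonian V).domain) (x : Vertex) :
    potentialPart f x = V x * (f : L2) x := by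
  rw [potentialPart, lp.coeFn_sub, Pi.sub_apply, hamiltonian_apply, add_sub_cancel_left]

theorem hamiltonian_eq_add (f : (hamiltonian V).domain) :
    hamiltonian V f = freeOp f + potentialPart f := by
  rw [potentialPart, add_sub_cancel]

theorem hasSum_inner_potentialPart (f : (hamiltonian V).domain) :
    HasSum (fun x => V x * ‖(f : L2) x‖ ^ 2) (inner ℂ (f : L2) (potentialPart f)).re ∧
      (inner ℂ (f : L2) (potentialPart f)).im = 0 := by
  have h := lp.hasSum_inner (𝕜 := ℂ) (f : L2) (potentialPart f)
  have e : ∀ x, inner ℂ ((f : L2) x) (potentialPart f x) = ((V x * ‖(f : L2) x‖ ^ 2 : ℝ) : ℂ) := by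
    intro x
    rw [potentialPart_apply, RCLike.inner_apply, mul_assoc, Complex.mul_conj,
      Complex.normSq_eq_norm_sq]
    push_cast
    ring
  simp only [e] at h
  refine ⟨Complex.hasSum_re h, ?_⟩
  have := Complex.hasSum_im h
  simp only [Complex.ofReal_im] at this
  exact this.unique hasSum_zero

theorem le_re_inner_potentialPart {a : ℝ} (ha : ∀ x, a ≤ V x) (f : (hamiltonian V).domain) :
    a * ‖(f : L2)‖ ^ 2 ≤ (inner ℂ (f : L2) (potentialPart f)).re :=
  hasSum_le (fun x => by gcongr; exact ha x) ((hasSum_norm_sq (f : L2)).mul_left a)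
    (hasSum_inner_potentialPart f).1

theorem re_inner_potentialPart_le {b : ℝ} (hb : ∀ x, V x ≤ b) (f : (hamiltonian V).domain) :
    (inner ℂ (f : L2) (potentialPart f)).re ≤ b * ‖(f : L2)‖ ^ 2 :=
  hasSum_le (fun x => by gcongr; exact hb x) (hasSum_inner_potentialPart f).1
    ((hasSum_norm_sq (f : L2)).mul_left b)

theorem le_norm_of_le_abs {E : Type*} [NormedAddCommGroup E] [InnerProductSpace ℂ E] {f g : E}
    {δ : ℝ} (h : δ * ‖f‖ ^ 2 ≤ ‖inner ℂ f g‖) : δ * ‖f‖ ≤ ‖g‖ := by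
  rcases (norm_nonneg f).eq_or_lt with h0 | h0
  · rw [← h0, mul_zero]
    exact norm_nonneg g
  · have := h.trans (norm_inner_le_norm f g)
    rw [pow_two, ← mul_assoc, mul_comm ‖f‖ ‖g‖] at this
    exact le_of_mul_le_mul_right this h0

/-- The form `⟨f, H f⟩` is real, so `⟨f, (H - z) f⟩` has imaginary part `-Im z · ‖f‖²`. -/
theorem im_mul_norm_le (f : (hamiltonian V).domain) (z : ℂ) :
    |z.im| * ‖(f : L2)‖ ≤ ‖hamiltonian V f - z • (f : L2)‖ := by
  refine le_norm_of_le_abs ?_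
  refine le_trans (le_of_eq ?_) (Complex.abs_im_le_norm _)
  have h1 : (inner ℂ (f : L2) (f : L2)).re = ‖(f : L2)‖ ^ 2 := inner_self_re_eq (f : L2)
  have h2 : (inner ℂ (f : L2) (f : L2)).im = 0 := inner_self_im (𝕜 := ℂ) (f : L2)
  rw [hamiltonian_eq_add, inner_sub_right, inner_add_right, inner_smul_right, Complex.sub_im,
    Complex.add_im, im_inner_map_self isSelfAdjoint_freeOp, (hasSum_inner_potentialPart f).2,
    Complex.mul_im, h1, h2, add_zero, mul_zero, zero_add, zero_sub, abs_neg, abs_mul,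
    abs_of_nonneg (sq_nonneg ‖(f : L2)‖)]

/-! ### Lower bounds and the resolvent set -/

/-- Tested against point masses, a vector orthogonal to the range of `H - z` satisfies the
eigenvalue equation for the conjugate of `z` pointwise. -/
theorem exists_hamiltonian_single (x : Vertex) : ∃ f : (hamiltonian V).domain, ∀ g : L2, ∀ z : ℂ,
    inner ℂ (hamiltonian V f - z • (f : L2)) g =
      freeOp g x + V x * g x - (starRingEnd ℂ) z * g x := by
  classical
  set e : L2 := lp.single 2 x (1 : ℂ) with he
  have hinner : ∀ g : L2, inner ℂ e g = g x := by
    intro g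
    rw [he, lp.inner_single_left]
    simp
  obtain ⟨hf, h⟩ := mem_domain_hamiltonian (V := V) (f := e) (g := freeOp e + (V x : ℂ) • e) <| by
    intro y
    rw [lp.coeFn_add, Pi.add_apply, lp.coeFn_smul, Pi.smul_apply, smul_eq_mul]
    rcases eq_or_ne y x with rfl | hy
    · rfl
    · have : e y = 0 := by rw [he, lp.single_apply_ne _ _ _ hy]
      rw [this, mul_zero, mul_zero]
  refine ⟨⟨e, hf⟩, fun g z => ?_⟩
  rw [h, inner_sub_left, inner_add_left, inner_smul_left, inner_smul_left, hinner,
    inner_map_comm isSelfAdjoint_freeOp, hinner, Complex.conj_ofReal]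

/-- The operator `-Δ + V - z` as a linear map on its domain. -/
def shiftedMap (V : Vertex → ℝ) (z : ℂ) : (hamiltonian V).domain →ₗ[ℂ] L2 :=
  (hamiltonian V).toFun - z • (hamiltonian V).domain.subtype

theorem shiftedMap_apply (z : ℂ) (f : (hamiltonian V).domain) :
    shiftedMap V z f = hamiltonian V f - z • (f : L2) := rfl

theorem tendsto_lp_apply {ι : Type*} {u : ℕ → lp (fun _ : ι => ℂ) 2} {f : lp (fun _ : ι => ℂ) 2}
    (h : Filter.Tendsto u Filter.atTop (nhds f)) (x : ι) :
    Filter.Tendsto (fun n => u n x) Filter.atTop (nhds (f x)) :=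
  ((lp.lipschitzWith_one_eval (E := fun _ : ι => ℂ) 2 x).continuous.tendsto f).comp h

/-- The operator `-Δ + V` is closed. -/
theorem hamiltonian_closed {u : ℕ → (hamiltonian V).domain} {f g : L2} {z : ℂ}
    (hu : Filter.Tendsto (fun n => (u n : L2)) Filter.atTop (nhds f))
    (hg : Filter.Tendsto (fun n => shiftedMap V z (u n)) Filter.atTop (nhds g)) :
    ∃ f' : (hamiltonian V).domain, shiftedMap V z f' = g := by
  have hA : Filter.Tendsto (fun n => freeOp (u n)) Filter.atTop (nhds (freeOp f)) :=
    (freeOp.continuous.tendsto f).comp hu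
  obtain ⟨hf, h⟩ := mem_domain_hamiltonian (V := V) (f := f) (g := g + z • f) <| by
    intro x
    have h1 := tendsto_lp_apply hg x
    have h2 := ((tendsto_lp_apply hA x).add ((tendsto_lp_apply hu x).const_mul (V x : ℂ))).sub
      ((tendsto_lp_apply hu x).const_mul z)
    have h3 : g x = freeOp f x + V x * f x - z * f x := by
      refine tendsto_nhds_unique h1 (h2.congr fun n => ?_)
      rw [shiftedMap_apply, lp.coeFn_sub, Pi.sub_apply, hamiltonian_apply, lp.coeFn_smul,
        Pi.smul_apply, smul_eq_mul]
    rw [lp.coeFn_add, Pi.add_apply, lp.coeFn_smul, Pi.smul_apply, smul_eq_mul, h3, sub_add_cancel]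
  exact ⟨⟨f, hf⟩, by rw [shiftedMap_apply, h, add_sub_cancel_right]⟩

/-- The bound at `z` gives injectivity, closed range (as `H` is closed) and an inverse of norm at
most `δ⁻¹`. The bound at the conjugate excludes eigenvectors there, so the range is dense. -/
theorem mem_resolventSet_of_bound {z : ℂ} {δ : ℝ} (hδ : 0 < δ)
    (h1 : ∀ f : (hamiltonian V).domain, δ * ‖(f : L2)‖ ≤ ‖hamiltonian V f - z • (f : L2)‖)
    (h2 : ∀ f : (hamiltonian V).domain,
      δ * ‖(f : L2)‖ ≤ ‖hamiltonian V f - (starRingEnd ℂ) z • (f : L2)‖) :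
    z ∈ resolventSet (hamiltonian V) := by
  have hinj : Function.Injective (shiftedMap V z) := by
    rw [← LinearMap.ker_eq_bot, LinearMap.ker_eq_bot']
    intro f hf
    have := h1 f
    rw [← shiftedMap_apply, hf, norm_zero] at this
    have h0 : ‖(f : L2)‖ ≤ 0 := by
      by_contra hpos
      push Not at hpos
      nlinarith
    exact Subtype.ext (norm_le_zero_iff.1 h0)
  have hdense : (LinearMap.range (shiftedMap V z)).topologicalClosure = ⊤ := by
    rw [Submodule.topologicalClosure_eq_top_iff, Submodule.eq_bot_iff]
    intro g hg
    obtain ⟨hgd, hgH⟩ := mem_domain_hamiltonian (V := V) (f := g) (g := (starRingEnd ℂ) z • g) <| by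
      intro x
      obtain ⟨f, hf⟩ := exists_hamiltonian_single (V := V) x
      have h3 := (Submodule.mem_orthogonal _ _).1 hg _ (LinearMap.mem_range_self _ f)
      rw [shiftedMap_apply, hf g z, sub_eq_zero] at h3
      rw [h3]
      rfl
    have h4 := h2 ⟨g, hgd⟩
    rw [hgH, sub_self, norm_zero] at h4
    have h0 : ‖g‖ ≤ 0 := by
      by_contra hpos
      push Not at hpos
      simp only at h4
      nlinarith
    exact norm_le_zero_iff.1 h0
  have hsurj : Function.Surjective (shiftedMap V z) := by
    intro g
    have hg : g ∈ (LinearMap.range (shiftedMap V z)).topologicalClosure := hdense ▸ trivial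
    obtain ⟨v, hv, hlim⟩ := mem_closure_iff_seq_limit.1 hg
    choose u hu using hv
    have hcau : CauchySeq fun n => (u n : L2) := by
      rw [Metric.cauchySeq_iff]
      intro ε hε
      obtain ⟨N, hN⟩ := Metric.cauchySeq_iff.1 hlim.cauchySeq (δ * ε) (by positivity)
      refine ⟨N, fun m hm n hn => ?_⟩
      have h5 := hN m hm n hn
      have h6 := h1 (u m - u n)
      rw [← shiftedMap_apply, map_sub, hu, hu, ← dist_eq_norm, AddSubgroupClass.coe_sub,
        ← dist_eq_norm] at h6
      exact lt_of_mul_lt_mul_left (h6.trans_lt h5) hδ.le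
    obtain ⟨f, hf⟩ := cauchySeq_tendsto_of_complete hcau
    exact hamiltonian_closed hf (hlim.congr fun n => (hu n).symm)
  set e := LinearEquiv.ofBijective (shiftedMap V z) ⟨hinj, hsurj⟩ with he
  have hes : ∀ g, shiftedMap V z (e.symm g) = g := fun g => e.apply_symm_apply g
  refine ⟨((hamiltonian V).domain.subtype ∘ₗ e.symm.toLinearMap).mkContinuous δ⁻¹ fun g => ?_,
    fun g => ⟨(e.symm g).2, hes g⟩, fun f => congrArg Subtype.val (e.symm_apply_apply f)⟩
  have h7 := h1 (e.symm g)
  rw [← shiftedMap_apply, hes] at h7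
  rw [← div_eq_inv_mul, le_div_iff₀ hδ, mul_comm]
  exact h7

theorem mem_resolventSet_of_im_ne_zero {z : ℂ} (hz : z.im ≠ 0) :
    z ∈ resolventSet (hamiltonian V) :=
  mem_resolventSet_of_bound (abs_pos.2 hz) (fun f => im_mul_norm_le f z) fun f => by
    simpa using im_mul_norm_le f ((starRingEnd ℂ) z)

theorem ofReal_mem_resolventSet {t δ : ℝ} (hδ : 0 < δ)
    (h : ∀ f : (hamiltonian V).domain,
      δ * ‖(f : L2)‖ ≤ ‖hamiltonian V f - (t : ℂ) • (f : L2)‖) :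
    (t : ℂ) ∈ resolventSet (hamiltonian V) :=
  mem_resolventSet_of_bound hδ h (by simpa using h)

theorem exists_ofReal_of_mem_opSpectrum {z : ℂ} (hz : z ∈ opSpectrum (hamiltonian V)) :
    ∃ t : ℝ, z = t :=
  ⟨z.re, Complex.ext rfl (by
    by_contra h
    exact hz (mem_resolventSet_of_im_ne_zero h))⟩

/-- Approximate eigenfunctions show that a number belongs to the spectrum. -/
theorem mem_opSpectrum_of_approx {E : Type*} [NormedAddCommGroup E] [NormedSpace ℂ E]
    {T : E →ₗ.[ℂ] E} {z : ℂ}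
    (h : ∀ ε > 0, ∃ f : T.domain, ‖T f - z • (f : E)‖ < ε * ‖(f : E)‖) : z ∈ opSpectrum T := by
  rintro ⟨R, -, hR⟩
  obtain ⟨f, hf⟩ := h (‖R‖ + 1)⁻¹ (by positivity)
  have h1 := R.le_opNorm (T f - z • (f : E))
  rw [hR f] at h1
  have h2 : ‖R‖ * ‖T f - z • (f : E)‖ ≤ (‖R‖ + 1) * ‖T f - z • (f : E)‖ := by
    gcongr
    linarith
  rw [← div_eq_inv_mul, lt_div_iff₀ (by positivity)] at hf
  linarith

theorem exists_approx_of_mem_opSpectrum_free {t : ℝ} (ht : (t : ℂ) ∈ opSpectrum free) {ε : ℝ}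
    (hε : 0 < ε) : ∃ f : L2, ‖freeOp f - (t : ℂ) • f‖ < ε * ‖f‖ := by
  by_contra! h
  rw [free_eq_hamiltonian] at ht
  refine ht (ofReal_mem_resolventSet hε fun f => ?_)
  have : hamiltonian 0 f = freeOp f := lp.ext (funext fun x => by rw [hamiltonian_apply]; simp)
  rw [this]
  exact h f

/-- This links the spectrum used by the functional calculus to that of operators with domain; the
upper bounds need only this inclusion. -/
theorem ofReal_mem_opSpectrum_free {t : ℝ} (ht : t ∈ spectrum ℝ freeOp) :
    (t : ℂ) ∈ opSpectrum free := by
  rintro ⟨R, hR1, hR2⟩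
  refine ht ?_
  have h1 : (freeOp - (t : ℂ) • 1) * R = 1 := by
    ext1 g
    obtain ⟨h, hg⟩ := hR1 g
    obtain ⟨h', hg'⟩ := mem_domain_free (R g)
    rw [hg'] at hg
    exact hg
  have h2 : R * (freeOp - (t : ℂ) • 1) = 1 := by
    ext1 g
    obtain ⟨h', hg'⟩ := mem_domain_free g
    have := hR2 ⟨g, h'⟩
    rw [hg'] at this
    exact this
  have h3 : IsUnit (freeOp - (t : ℂ) • 1) := ⟨⟨_, R, h1, h2⟩, rfl⟩
  have e : algebraMap ℝ (L2 →L[ℂ] L2) t - freeOp = -(freeOp - (t : ℂ) • 1) := by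
    rw [neg_sub, Algebra.algebraMap_eq_smul_one]
    rfl
  rw [spectrum.mem_resolventSet_iff, e]
  exact h3.neg

end SierpinskiAnderson

namespace SierpinskiAnderson

/-! ### Upper bounds for the spectrum -/

variable {V : Vertex → ℝ}

theorem norm_potentialPart_sub_apply (f : (hamiltonian V).domain) (c : ℝ) (x : Vertex) :
    ‖(potentialPart f - (c : ℂ) • (f : L2)) x‖ ^ 2 = |V x - c| ^ 2 * ‖(f : L2) x‖ ^ 2 := by
  rw [lp.coeFn_sub, Pi.sub_apply, lp.coeFn_smul, Pi.smul_apply, smul_eq_mul, potentialPart_apply,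
    ← sub_mul, norm_mul, ← Complex.ofReal_sub, Complex.norm_real, Real.norm_eq_abs, mul_pow]

theorem le_norm_potentialPart_sub {c d : ℝ} (hd : 0 ≤ d) (h : ∀ x, d ≤ |V x - c|)
    (f : (hamiltonian V).domain) :
    d * ‖(f : L2)‖ ≤ ‖potentialPart f - (c : ℂ) • (f : L2)‖ := by
  refine (sq_le_sq₀ (by positivity) (norm_nonneg _)).1 ?_
  rw [mul_pow]
  refine hasSum_le (fun x => ?_) ((hasSum_norm_sq (f : L2)).mul_left (d ^ 2)) (hasSum_norm_sq _)
  rw [norm_potentialPart_sub_apply]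
  gcongr
  exact h x

theorem norm_potentialPart_sub_le {c r : ℝ} (hr : 0 ≤ r) (h : ∀ x, |V x - c| ≤ r)
    (f : (hamiltonian V).domain) :
    ‖potentialPart f - (c : ℂ) • (f : L2)‖ ≤ r * ‖(f : L2)‖ := by
  refine (sq_le_sq₀ (norm_nonneg _) (by positivity)).1 ?_
  rw [mul_pow]
  refine hasSum_le (fun x => ?_) (hasSum_norm_sq _) ((hasSum_norm_sq (f : L2)).mul_left (r ^ 2))
  rw [norm_potentialPart_sub_apply]
  gcongr
  exact h x

theorem opSpectrum_hamiltonian_subset_Icc_add {S : Set ℝ} (hS : IsClosed S) (hne : S.Nonempty)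
    (hV : ∀ x, V x ∈ S) :
    opSpectrum (hamiltonian V) ⊆ Complex.ofReal '' (Set.Icc 0 6 + S) := by
  intro z hz
  obtain ⟨t, rfl⟩ := exists_ofReal_of_mem_opSpectrum hz
  refine ⟨t, ?_, rfl⟩
  by_contra ht
  refine hz ?_
  -- The shift by `3` centres `[0, 6]`: `t ∉ [0, 6] + S` says that `t - 3` has distance more than
  -- `3` from `S`.
  obtain ⟨s, hs, hd⟩ := hS.exists_infDist_eq_dist hne (t - 3)
  have h3 : 3 < dist (t - 3) s := by
    by_contra hle
    push Not at hle
    rw [Real.dist_eq, abs_le] at hle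
    exact ht ⟨t - s, ⟨by linarith, by linarith⟩, s, hs, by ring⟩
  have hlow : ∀ x, dist (t - 3) s ≤ |V x - (t - 3)| := by
    intro x
    rw [← hd, ← Real.dist_eq, dist_comm]
    exact Metric.infDist_le_dist_of_mem (hV x)
  refine ofReal_mem_resolventSet (sub_pos.2 h3) fun f => ?_
  have h1 := le_norm_potentialPart_sub dist_nonneg hlow f
  have h2 := norm_freeOp_sub_le f
  have e : hamiltonian V f - (t : ℂ) • (f : L2) =
      (potentialPart f - ((t - 3 : ℝ) : ℂ) • (f : L2)) + (freeOp f - (3 : ℂ) • (f : L2)) := by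
    rw [hamiltonian_eq_add]
    push_cast
    module
  have h4 := norm_sub_le_norm_add (potentialPart f - ((t - 3 : ℝ) : ℂ) • (f : L2))
    (freeOp f - (3 : ℂ) • (f : L2))
  rw [e]
  linarith

theorem lattice_origin_mem : ((0, 0) : ℤ × ℤ) ∈ latticeVertices :=
  (mem_latticeVertices_of_corner (mem_allCorners_zero 0)).1

instance : Nonempty Vertex := ⟨⟨_, lattice_origin_mem⟩⟩

instance : Nontrivial L2 := by
  classical
  obtain ⟨x⟩ := (inferInstance : Nonempty Vertex)
  refine ⟨lp.single 2 x 1, 0, fun h => ?_⟩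
  have := congrArg norm h
  rw [lp.norm_single (by norm_num), norm_zero] at this
  simp at this

theorem isCompact_spectrum_real {E : Type*} [NormedAddCommGroup E] [InnerProductSpace ℂ E]
    [CompleteSpace E] (A : E →L[ℂ] E) : IsCompact (spectrum ℝ A) :=
  spectrum.isCompact A

theorem valueInterval_cases (V : Vertex → ℝ) :
    (∃ a b : ℝ, (∀ x, a ≤ V x) ∧ (∀ x, V x ≤ b) ∧ Set.Icc a b ⊆ valueInterval V) ∨
    (∃ a : ℝ, (∀ x, a ≤ V x) ∧ Set.Ici a ⊆ valueInterval V) ∨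
    (∃ b : ℝ, (∀ x, V x ≤ b) ∧ Set.Iic b ⊆ valueInterval V) ∨
    valueInterval V = Set.univ := by
  obtain ⟨x₀⟩ := (inferInstance : Nonempty Vertex)
  have hinf : ∀ x, (⨅ x, (V x : EReal)) ≤ V x := fun x => iInf_le _ x
  have hsup : ∀ x, (V x : EReal) ≤ ⨆ x, (V x : EReal) := fun x => le_iSup (fun x => (V x : EReal)) x
  have htop : (⨅ x, (V x : EReal)) ≠ ⊤ := fun h => by
    have := hinf x₀
    rw [h] at this
    exact EReal.coe_ne_top _ (top_le_iff.1 this)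
  have hbot : (⨆ x, (V x : EReal)) ≠ ⊥ := fun h => by
    have := hsup x₀
    rw [h] at this
    exact EReal.coe_ne_bot _ (le_bot_iff.1 this)
  simp only [valueInterval]
  generalize (⨅ x, (V x : EReal)) = a at *
  generalize (⨆ x, (V x : EReal)) = b at *
  induction a with
  | top => exact absurd rfl htop
  | bot =>
    induction b with
    | top => exact Or.inr (Or.inr (Or.inr (by simp)))
    | bot => exact absurd rfl hbot
    | coe b =>
      refine Or.inr (Or.inr (Or.inl ⟨b, fun x => by exact_mod_cast hsup x, fun t ht => ?_⟩))
      exact ⟨bot_le, by exact_mod_cast ht⟩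
  | coe a =>
    induction b with
    | top =>
      refine Or.inr (Or.inl ⟨a, fun x => by exact_mod_cast hinf x, fun t ht => ?_⟩)
      exact ⟨by exact_mod_cast ht, le_top⟩
    | bot => exact absurd rfl hbot
    | coe b =>
      refine Or.inl ⟨a, b, fun x => by exact_mod_cast hinf x, fun x => by exact_mod_cast hsup x,
        fun t ht => ?_⟩
      exact ⟨by exact_mod_cast ht.1, by exact_mod_cast ht.2⟩

theorem re_inner_hamiltonian_sub (f : (hamiltonian V).domain) (t : ℝ) :
    (inner ℂ (f : L2) (hamiltonian V f - (t : ℂ) • (f : L2))).re =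
      (inner ℂ (f : L2) (freeOp f)).re + (inner ℂ (f : L2) (potentialPart f)).re -
        t * ‖(f : L2)‖ ^ 2 := by
  have h1 : (inner ℂ (f : L2) (f : L2)).re = ‖(f : L2)‖ ^ 2 := inner_self_re_eq (f : L2)
  rw [hamiltonian_eq_add, inner_sub_right, inner_add_right, inner_smul_right, Complex.sub_re,
    Complex.add_re, Complex.re_ofReal_mul, h1]

theorem opSpectrum_hamiltonian_subset_add_valueInterval (V : Vertex → ℝ) :
    opSpectrum (hamiltonian V) ⊆ opSpectrum free + Complex.ofReal '' valueInterval V := by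
  intro z hz
  obtain ⟨t, rfl⟩ := exists_ofReal_of_mem_opSpectrum hz
  by_contra hmem
  have hout : ∀ s ∈ spectrum ℝ freeOp, t - s ∉ valueInterval V := fun s hs h =>
    hmem ⟨s, ofReal_mem_opSpectrum_free hs, ((t - s : ℝ) : ℂ), ⟨_, h, rfl⟩, by push_cast; ring⟩
  have hcpt : IsCompact (spectrum ℝ freeOp) := isCompact_spectrum_real freeOp
  have hne : (spectrum ℝ freeOp).Nonempty := spectrum_real_nonempty isSelfAdjoint_freeOp
  refine hz ?_
  rcases valueInterval_cases V with ⟨a, b, ha, hb, hI⟩ | ⟨a, ha, hI⟩ | ⟨b, hb, hI⟩ | hI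
  · obtain ⟨x₀⟩ := (inferInstance : Nonempty Vertex)
    have hab : a ≤ b := (ha x₀).trans (hb x₀)
    -- With midpoint `m` and half-length `r`, `V - m` has norm at most `r`, while `t - m` is farther
    -- than `r` from the compact spectrum of `-Δ`.
    set m := (a + b) / 2 with hm
    set r := (b - a) / 2 with hr
    obtain ⟨s, hs, hd⟩ := hcpt.isClosed.exists_infDist_eq_dist hne (t - m)
    have hrd : r < dist (t - m) s := by
      by_contra hle
      push Not at hle
      rw [Real.dist_eq, abs_le] at hle
      exact hout s hs (hI ⟨by linarith, by linarith⟩)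
    refine ofReal_mem_resolventSet (sub_pos.2 hrd) fun f => ?_
    have h1 := le_norm_sub_smul_of_spectrum isSelfAdjoint_freeOp (w := t - m) dist_nonneg
      (fun u hu => by
        rw [← hd, ← Real.dist_eq, dist_comm]
        exact Metric.infDist_le_dist_of_mem hu) (f : L2)
    have h2 := norm_potentialPart_sub_le (V := V) (c := m) (r := r) (by linarith)
      (fun x => abs_le.2 ⟨by linarith [ha x], by linarith [hb x]⟩) f
    have e : hamiltonian V f - (t : ℂ) • (f : L2) =
        (freeOp f - ((t - m : ℝ) : ℂ) • (f : L2)) + (potentialPart f - (m : ℂ) • (f : L2)) := by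
      rw [hamiltonian_eq_add, Complex.ofReal_sub]
      module
    have h4 := norm_sub_le_norm_add (freeOp f - ((t - m : ℝ) : ℂ) • (f : L2))
      (potentialPart f - (m : ℂ) • (f : L2))
    rw [e]
    linarith
  -- Now `σ(-Δ) + [a, ∞)` is a half-line starting at `s + a`, and the form of `H - t` is at least `s
  -- + a - t > 0`. The next case is its mirror image.
  · obtain ⟨s, hs, hmin⟩ := hcpt.exists_isLeast hne
    have hlt : t - s < a := by
      by_contra hle
      exact hout s hs (hI (not_lt.1 hle))
    refine ofReal_mem_resolventSet (δ := s + a - t) (by linarith) fun f => ?_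
    refine le_norm_of_le_abs (le_trans ?_ (Complex.re_le_norm _))
    rw [re_inner_hamiltonian_sub]
    have h1 : s * ‖(f : L2)‖ ^ 2 ≤ (inner ℂ (f : L2) (freeOp f)).re :=
      le_re_inner_of_spectrum isSelfAdjoint_freeOp (fun u hu => hmin hu) (f : L2)
    have h2 := le_re_inner_potentialPart ha f
    linarith
  · obtain ⟨s, hs, hmax⟩ := hcpt.exists_isGreatest hne
    have hlt : b < t - s := by
      by_contra hle
      exact hout s hs (hI (not_lt.1 hle))
    refine ofReal_mem_resolventSet (δ := t - s - b) (by linarith) fun f => ?_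
    refine le_norm_of_le_abs (le_trans ?_ ((neg_le_abs _).trans (Complex.abs_re_le_norm _)))
    rw [re_inner_hamiltonian_sub]
    have h1 : (inner ℂ (f : L2) (freeOp f)).re ≤ s * ‖(f : L2)‖ ^ 2 :=
      re_inner_le_of_spectrum isSelfAdjoint_freeOp (fun u hu => hmax hu) (f : L2)
    have h2 := re_inner_potentialPart_le hb f
    linarith
  · obtain ⟨s, hs⟩ := hne
    exact absurd (hI ▸ Set.mem_univ _) (hout s hs)

/-- The infimum and the supremum need not be attained. But if `t ∉ S`, no value lies within some `ε`
of `t`, so values below `t + ε` and above `t - ε` lie on either side of `t`, and convexity forces `t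
∈ S`. -/
theorem valueInterval_subset {S : Set ℝ} (hS : IsClosed S) (hS' : S.OrdConnected)
    (hV : ∀ x, V x ∈ S) : valueInterval V ⊆ S := by
  rintro t ⟨h1, h2⟩
  by_contra ht
  obtain ⟨ε, hε, hball⟩ := Metric.isOpen_iff.1 hS.isOpen_compl t ht
  have hlow : ∃ x, V x < t + ε := by
    by_contra! h
    have : ((t + ε : ℝ) : EReal) ≤ ⨅ x, (V x : EReal) := le_iInf fun x => by exact_mod_cast h x
    have := this.trans h1
    norm_cast at this
    linarith
  have hup : ∃ x, t - ε < V x := by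
    by_contra! h
    have : (⨆ x, (V x : EReal)) ≤ ((t - ε : ℝ) : EReal) := iSup_le fun x => by exact_mod_cast h x
    have := h2.trans this
    norm_cast at this
    linarith
  obtain ⟨x, hx⟩ := hlow
  obtain ⟨y, hy⟩ := hup
  have hfar : ∀ x, ε ≤ |V x - t| := by
    intro x
    by_contra! h
    exact hball (by rwa [Metric.mem_ball, Real.dist_eq]) (hV x)
  have hx' : V x ≤ t := by
    by_contra! h
    have := hfar x
    rw [abs_of_pos (by linarith)] at this
    linarith
  have hy' : t ≤ V y := by
    by_contra! h
    have := hfar y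
    rw [abs_of_neg (by linarith)] at this
    linarith
  exact ht (hS'.out (hV x) (hV y) ⟨hx', hy'⟩)

end SierpinskiAnderson

namespace SierpinskiAnderson

/-! ### Translated approximate eigenfunctions -/

theorem hasSum_zeroExtend_iff {f : Vertex → ℂ} {s : ℝ} :
    HasSum (fun p => ‖zeroExtend f p‖ ^ 2) s ↔ HasSum (fun x => ‖f x‖ ^ 2) s := by
  rw [← hasSum_subtype_iff_of_support_subset (s := latticeVertices)]
  · have : ((fun p => ‖zeroExtend f p‖ ^ 2) ∘ Subtype.val : latticeVertices → ℝ) =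
        fun x => ‖f x‖ ^ 2 := funext fun x => by simp [zeroExtend_coe]
    rw [this]
  · intro p hp
    by_contra hmem
    exact hp (by simp [zeroExtend_of_notMem _ hmem])

theorem hasSum_zeroExtend_translate (f : L2) (c : ℤ × ℤ) :
    HasSum (fun p => ‖zeroExtend f (p - c)‖ ^ 2) (‖f‖ ^ 2) :=
  (Equiv.subRight c).hasSum_iff.2 (hasSum_zeroExtend_iff.2 (hasSum_norm_sq f))

theorem norm_eq_of_translate {f g : L2} {c : ℤ × ℤ}
    (h : ∀ p, zeroExtend g p = zeroExtend f (p - c)) : ‖g‖ = ‖f‖ := by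
  have h1 := hasSum_zeroExtend_translate f c
  simp only [← h] at h1
  exact (sq_eq_sq₀ (norm_nonneg _) (norm_nonneg _)).1
    ((hasSum_norm_sq g).unique (hasSum_zeroExtend_iff.1 h1))

/-- Off the lattice all terms vanish, so the formula holds on all of `ℤ × ℤ` and can be translated
freely. -/
theorem zeroExtend_freeOp (f : L2) (p : ℤ × ℤ) :
    zeroExtend (freeOp f) p = 6 * zeroExtend f p - (triangleSum (zeroExtend f) p +
      triangleSum (zeroExtend f) (p - (1, 0)) + triangleSum (zeroExtend f) (p - (0, 1))) := by
  by_cases hp : p ∈ latticeVertices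
  · have h1 := zeroExtend_coe (freeOp f) ⟨p, hp⟩
    have h2 := zeroExtend_coe f ⟨p, hp⟩
    have h3 := neg_laplacian_apply f ⟨p, hp⟩
    rw [← freeOp_apply, ← h1, ← h2] at h3
    exact h3
  · have h := hp
    rw [mem_latticeVertices_iff', not_or, not_or] at h
    rw [zeroExtend_of_notMem _ hp, zeroExtend_of_notMem _ hp, triangleSum_of_notMem _ h.1,
      triangleSum_of_notMem _ h.2.1, triangleSum_of_notMem _ h.2.2]
    ring

/-- A function supported below the height `2 ^ n` may be translated by `(2 ^ n * k, 0)`. -/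
theorem exists_translate (f : L2) (n : ℕ) (k : ℤ)
    (hf : ∀ p : ℤ × ℤ, 2 ^ n ≤ p.2 → zeroExtend f p = 0) :
    ∃ g : L2, (∀ p, zeroExtend g p = zeroExtend f (p - (2 ^ n * k, 0))) ∧
      ∀ p, zeroExtend (freeOp g) p = zeroExtend (freeOp f) (p - (2 ^ n * k, 0)) := by
  set c : ℤ × ℤ := (2 ^ n * k, 0) with hc
  have hext : ∀ p, zeroExtend (fun x : Vertex => zeroExtend f (x - c)) p =
      zeroExtend f (p - c) := by
    intro p
    by_cases hp : p ∈ latticeVertices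
    · exact zeroExtend_coe (fun x : Vertex => zeroExtend f (x - c)) ⟨p, hp⟩
    · rw [zeroExtend_of_notMem _ hp]
      rcases lt_or_ge p.2 (2 ^ n) with h | h
      · rw [zeroExtend_of_notMem]
        rwa [hc, latticeVertices_translate n k p h]
      · rw [hf]
        simpa [hc] using h
  have hmem : Memℓp (fun x : Vertex => zeroExtend f (x - c)) 2 := by
    rw [memℓp_two_iff]
    exact (hasSum_zeroExtend_iff.1 ((hasSum_zeroExtend_translate f c).congr_fun fun p => by
      rw [hext])).summable
  set g : L2 := ⟨_, hmem⟩ with hgdef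
  have hg : ∀ p, zeroExtend g p = zeroExtend f (p - c) := hext
  have hsum : ∀ p, triangleSum (zeroExtend g) p = triangleSum (zeroExtend f) (p - c) := by
    intro p
    -- Below height `2 ^ n` the corners are periodic. From there on triangles reach only upwards,
    -- where both functions vanish.
    rcases lt_or_ge p.2 (2 ^ n) with h | h
    · have hiff := allCorners_translate n k p h
      rw [← hc] at hiff
      by_cases hp : p ∈ allCorners
      · rw [triangleSum_of_mem _ hp, triangleSum_of_mem _ (hiff.2 hp), hg, hg, hg,
          add_sub_right_comm, add_sub_right_comm p (0, 1)]
      · rw [triangleSum_of_notMem _ hp, triangleSum_of_notMem _ fun h' => hp (hiff.1 h')]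
    · have h0 : ∀ q : ℤ × ℤ, 2 ^ n ≤ q.2 → triangleSum (zeroExtend f) q = 0 := by
        intro q hq
        by_cases hq' : q ∈ allCorners
        · rw [triangleSum_of_mem _ hq', hf _ hq, hf _ (by simpa using hq),
            hf _ (by simp; omega)]
          ring
        · exact triangleSum_of_notMem _ hq'
      have h1 : ∀ q : ℤ × ℤ, 2 ^ n ≤ q.2 → zeroExtend g q = 0 := by
        intro q hq
        rw [hg, hf]
        simpa [hc] using hq
      rw [h0 _ (by simpa [hc] using h)]
      by_cases hp : p ∈ allCorners
      · rw [triangleSum_of_mem _ hp, h1 _ h, h1 _ (by simpa using h), h1 _ (by simp; omega)]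
        ring
      · exact triangleSum_of_notMem _ hp
  refine ⟨g, hg, fun p => ?_⟩
  rw [zeroExtend_freeOp, zeroExtend_freeOp, hg, hsum, hsum, hsum, sub_right_comm,
    sub_right_comm p (0, 1)]

/-- The strict inequality is an open condition, so it survives a good enough finite truncation. -/
theorem exists_finite_support_approx {t : ℝ} (ht : (t : ℂ) ∈ opSpectrum free) {ε : ℝ}
    (hε : 0 < ε) : ∃ (f : L2) (s : Finset (ℤ × ℤ)), (∀ p ∉ s, zeroExtend f p = 0) ∧
      ‖freeOp f - (t : ℂ) • f‖ < ε * ‖f‖ := by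
  classical
  obtain ⟨f, hf⟩ := exists_approx_of_mem_opSpectrum_free ht hε
  have hopen : IsOpen {g : L2 | ‖freeOp g - (t : ℂ) • g‖ < ε * ‖g‖} :=
    isOpen_lt (by fun_prop) (by fun_prop)
  have hsum := lp.hasSum_single (E := fun _ : Vertex => ℂ) (p := 2) (by norm_num) f
  obtain ⟨s, hs⟩ := (hsum.eventually (hopen.mem_nhds hf)).exists
  refine ⟨_, s.map (Function.Embedding.subtype _), fun p hp => ?_, hs⟩
  by_cases hmem : p ∈ latticeVertices
  · have h1 := zeroExtend_coe (∑ x ∈ s, lp.single 2 x (f x) : L2) ⟨p, hmem⟩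
    simp only at h1
    rw [h1, lp.coeFn_sum, Finset.sum_apply]
    refine Finset.sum_eq_zero fun x hx => ?_
    refine lp.single_apply_ne _ _ _ fun h => hp ?_
    rw [Finset.mem_map]
    exact ⟨x, hx, congrArg Subtype.val h.symm⟩
  · exact zeroExtend_of_notMem _ hmem

theorem zeroExtend_sub_smul (f g : L2) (c : ℂ) (p : ℤ × ℤ) :
    zeroExtend (f - c • g : L2) p = zeroExtend f p - c * zeroExtend g p := by
  by_cases h : p ∈ latticeVertices
  · simp only [zeroExtend, dif_pos h]
    rfl
  · simp [zeroExtend, h]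

theorem add_mem_opSpectrum_hamiltonian {V : Vertex → ℝ} {t v : ℝ} (ht : (t : ℂ) ∈ opSpectrum free)
    (hV : ∀ (s : Finset (ℤ × ℤ)) (n : ℕ), (∀ p ∈ s, ∀ q ∈ s, |p.1 - q.1| < 2 ^ n) → ∀ ε > 0,
      ∃ k : ℕ, ∀ x : Vertex, (x : ℤ × ℤ) - (2 ^ n * (k : ℤ), 0) ∈ s → |V x - v| < ε) :
    ((t + v : ℝ) : ℂ) ∈ opSpectrum (hamiltonian V) := by
  refine mem_opSpectrum_of_approx fun ε hε => ?_
  obtain ⟨f, s, hfs, hf⟩ := exists_finite_support_approx ht (half_pos hε)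
  obtain ⟨B, hB⟩ : ∃ B : ℤ, ∀ p ∈ s, |p.1| + |p.2| ≤ B := by
    obtain ⟨B, hB⟩ := (s.image fun p : ℤ × ℤ => |p.1| + |p.2|).bddAbove
    exact ⟨B, fun p hp => hB (Finset.mem_coe.2 (Finset.mem_image_of_mem _ hp))⟩
  -- The factor `2` makes the support narrower than `2 ^ n`, so that its translates are disjoint, as
  -- well as lower than `2 ^ n`.
  obtain ⟨n, hn, -⟩ := exists_lt_two_pow (2 * B) 0
  have hs1 : ∀ p ∈ s, ∀ q ∈ s, |p.1 - q.1| < 2 ^ n := by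
    intro p hp q hq
    have h1 := hB p hp
    have h2 := hB q hq
    have h3 := abs_sub p.1 q.1
    have h4 := abs_nonneg p.2
    have h5 := abs_nonneg q.2
    linarith
  have hs2 : ∀ p ∈ s, p.2 < 2 ^ n := by
    intro p hp
    have h1 := hB p hp
    have h2 := abs_nonneg p.1
    have h3 := abs_nonneg p.2
    have h4 := le_abs_self p.2
    linarith
  obtain ⟨k, hk⟩ := hV s n hs1 (ε / 2) (half_pos hε)
  obtain ⟨g, hg1, hg2⟩ := exists_translate f n k fun p hp =>
    hfs p fun hmem => absurd (hs2 p hmem) (not_lt.2 hp)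
  have hnorm : ‖g‖ = ‖f‖ := norm_eq_of_translate hg1
  have hnorm' : ‖freeOp g - (t : ℂ) • g‖ = ‖freeOp f - (t : ℂ) • f‖ :=
    norm_eq_of_translate (c := (2 ^ n * (k : ℤ), 0)) fun p => by
      rw [zeroExtend_sub_smul, zeroExtend_sub_smul, hg1, hg2]
  have hpt : ∀ x : Vertex, ‖((V x - v : ℝ) : ℂ) * g x‖ ^ 2 ≤ (ε / 2) ^ 2 * ‖g x‖ ^ 2 := by
    intro x
    rw [norm_mul, mul_pow, Complex.norm_real, Real.norm_eq_abs]
    by_cases hx : (x : ℤ × ℤ) - (2 ^ n * (k : ℤ), 0) ∈ s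
    · have := hk x hx
      gcongr
    · have : g x = 0 := by rw [← zeroExtend_coe g x, hg1, hfs _ hx]
      simp [this]
  have hmem : Memℓp (fun x : Vertex => ((V x - v : ℝ) : ℂ) * g x) 2 := by
    rw [memℓp_two_iff]
    exact Summable.of_nonneg_of_le (fun _ => by positivity) hpt
      ((hasSum_norm_sq g).mul_left _).summable
  -- The error `(V - v) g` is small because `g` lives on the window where `V` is close to `v`.
  set d : L2 := ⟨_, hmem⟩ with hd
  have hdnorm : ‖d‖ ≤ ε / 2 * ‖g‖ := by
    refine (sq_le_sq₀ (norm_nonneg _) (by positivity)).1 ?_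
    rw [mul_pow]
    exact hasSum_le hpt (hasSum_norm_sq d) ((hasSum_norm_sq g).mul_left _)
  obtain ⟨hdom, hH⟩ := mem_domain_hamiltonian (V := V) (f := g)
    (g := freeOp g + (v : ℂ) • g + d) fun x => by
      have : d x = ((V x - v : ℝ) : ℂ) * g x := rfl
      rw [lp.coeFn_add, Pi.add_apply, lp.coeFn_add, Pi.add_apply, lp.coeFn_smul, Pi.smul_apply,
        smul_eq_mul, this]
      push_cast
      ring
  refine ⟨⟨g, hdom⟩, ?_⟩
  rw [hH]
  have e : freeOp g + (v : ℂ) • g + d - ((t + v : ℝ) : ℂ) • g = (freeOp g - (t : ℂ) • g) + d := by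
    push_cast
    module
  simp only
  rw [e]
  refine (norm_add_le _ _).trans_lt ?_
  rw [hnorm']
  rw [← hnorm] at hf
  linarith

end SierpinskiAnderson

namespace SierpinskiAnderson

/-! ### Windows on which the random potential is almost constant -/

section Probability

variable {Ω : Type*} [MeasurableSpace Ω] {P : Measure Ω} [IsProbabilityMeasure P]

/-- If the events `V x ∈ U` are considered on disjoint finite windows of bounded size, then almost
surely all of them happen on one of the windows. -/
theorem ae_exists_window {ι : Type*} {P₀ : Measure ℝ} {V : ι → Ω → ℝ} (hmeas : ∀ x, Measurable (V x))
    (hindep : iIndepFun V P) (hlaw : ∀ x, Measure.map (V x) P = P₀) {U : Set ℝ}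
    (hU : MeasurableSet U) (hpos : P₀ U ≠ 0) (W : ℕ → Finset ι)
    (hdisj : Pairwise fun k l => Disjoint (W k) (W l)) {N : ℕ} (hcard : ∀ k, (W k).card ≤ N) :
    ∀ᵐ ω ∂P, ∃ k, ∀ x ∈ W k, V x ω ∈ U := by
  classical
  set E : ℕ → Set Ω := fun k => ⋂ x ∈ W k, V x ⁻¹' U with hE
  have hEm : ∀ k, MeasurableSet (E k) := fun k =>
    Finset.measurableSet_biInter _ fun x _ => hmeas x hU
  have hprob : ∀ s : Finset ι, P (⋂ x ∈ s, V x ⁻¹' U) = ∏ x ∈ s, P (V x ⁻¹' U) := fun s =>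
    hindep.measure_inter_preimage_eq_mul s fun _ _ => hU
  have hind : iIndepSet E P := by
    rw [iIndepSet_iff_meas_biInter hEm]
    intro s
    have : ⋂ k ∈ s, E k = ⋂ x ∈ s.biUnion W, V x ⁻¹' U := by
      rw [Finset.set_biInter_biUnion]
    rw [this, hprob, Finset.prod_biUnion fun k _ l _ hkl => hdisj hkl]
    exact Finset.prod_congr rfl fun k _ => (hprob _).symm
  rcases isEmpty_or_nonempty ι with hι | ⟨⟨x₀⟩⟩
  · exact Filter.Eventually.of_forall fun ω => ⟨0, fun x => (hι.false x).elim⟩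
  have hle1 : P₀ U ≤ 1 := by
    rw [← hlaw x₀, Measure.map_apply (hmeas x₀) hU]
    exact prob_le_one
  -- The bounded window size gives a lower bound independent of `k`, so the probabilities sum to
  -- infinity, as Borel–Cantelli requires.
  have hPE : ∀ k, P₀ U ^ N ≤ P (E k) := by
    intro k
    have : P (E k) = P₀ U ^ (W k).card := by
      rw [hE, hprob, Finset.prod_eq_pow_card]
      intro x _
      rw [← hlaw x, Measure.map_apply (hmeas x) hU]
    rw [this]
    exact pow_le_pow_right_of_le_one' hle1 (hcard k)
  have hsum : ∑' k, P (E k) = ⊤ := by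
    refine top_le_iff.1 (le_trans (le_of_eq ?_) (ENNReal.tsum_le_tsum hPE))
    exact (ENNReal.tsum_const_eq_top_of_ne_zero (pow_ne_zero _ hpos)).symm
  have hlim := measure_limsup_eq_one hEm hind hsum
  have hae : ∀ᵐ ω ∂P, ω ∈ Filter.limsup E Filter.atTop :=
    (prob_compl_eq_zero_iff (MeasurableSet.measurableSet_limsup hEm)).2 hlim
  filter_upwards [hae] with ω hω
  rw [Filter.mem_limsup_iff_frequently_mem] at hω
  obtain ⟨k, hk⟩ := hω.exists
  exact ⟨k, by simpa [hE] using hk⟩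

/-- One null set must serve uncountably many `v` and `ε`; rational balls of positive mass reduce
this to countably many events. -/
theorem ae_exists_translate {P₀ : Measure ℝ} {V : Vertex → Ω → ℝ} (hmeas : ∀ x, Measurable (V x))
    (hindep : iIndepFun V P) (hlaw : ∀ x, Measure.map (V x) P = P₀) :
    ∀ᵐ ω ∂P, ∀ v ∈ P₀.support, ∀ (s : Finset (ℤ × ℤ)) (n : ℕ),
      (∀ p ∈ s, ∀ q ∈ s, |p.1 - q.1| < 2 ^ n) → ∀ ε > 0,
      ∃ k : ℕ, ∀ x : Vertex, (x : ℤ × ℤ) - (2 ^ n * (k : ℤ), 0) ∈ s → |V x ω - v| < ε := by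
  have hall : ∀ᵐ ω ∂P, ∀ (q r : ℚ) (s : Finset (ℤ × ℤ)) (n : ℕ),
      P₀ (Metric.ball (q : ℝ) r) ≠ 0 → (∀ p ∈ s, ∀ q ∈ s, |p.1 - q.1| < 2 ^ n) →
      ∃ k : ℕ, ∀ x : Vertex, (x : ℤ × ℤ) - (2 ^ n * (k : ℤ), 0) ∈ s →
        V x ω ∈ Metric.ball (q : ℝ) r := by
    simp only [ae_all_iff]
    intro q r s n hpos hs
    have hinj : ∀ c : ℤ × ℤ, Function.Injective fun x : Vertex => (x : ℤ × ℤ) - c :=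
      fun c x y h => Subtype.ext (sub_left_injective h)
    have h := ae_exists_window hmeas hindep hlaw (U := Metric.ball (q : ℝ) r)
      measurableSet_ball hpos
      (fun k : ℕ => s.preimage (fun x : Vertex => (x : ℤ × ℤ) - (2 ^ n * (k : ℤ), 0))
        (hinj _).injOn) ?_ (N := s.card) fun k =>
        Finset.card_le_card_of_injOn (fun x : Vertex => (x : ℤ × ℤ) - (2 ^ n * (k : ℤ), 0))
          (fun x hx => by simpa using hx) (hinj _).injOn
    · simpa only [Finset.mem_preimage] using h
    -- A vertex common to two windows would give two points of `s` at horizontal distance at least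
    -- `2 ^ n`.
    · intro k l hkl
      rw [Finset.disjoint_left]
      intro x hxk hxl
      rw [Finset.mem_preimage] at hxk hxl
      have h1 := hs _ hxk _ hxl
      have h2 : (1 : ℤ) ≤ |(l : ℤ) - k| := Int.one_le_abs (by omega)
      have h3 : ((x : ℤ × ℤ) - (2 ^ n * (k : ℤ), 0)).1 - ((x : ℤ × ℤ) - (2 ^ n * (l : ℤ), 0)).1 =
          2 ^ n * ((l : ℤ) - k) := by
        simp only [Prod.fst_sub]
        ring
      rw [h3, abs_mul, abs_of_pos (by positivity : (0 : ℤ) < 2 ^ n)] at h1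
      have h4 : (0 : ℤ) < 2 ^ n := by positivity
      nlinarith
  filter_upwards [hall] with ω hω v hv s n hs ε hε
  -- The ball has diameter at most `2 r < ε`, and it has positive mass because it contains the
  -- support point `v`.
  obtain ⟨r, hr0, hr⟩ := exists_rat_btwn (half_pos hε)
  obtain ⟨q, hq1, hq2⟩ := exists_rat_btwn (show v < v + r by linarith)
  have hvq : v ∈ Metric.ball (q : ℝ) r := by
    rw [Metric.mem_ball, Real.dist_eq, abs_lt]
    constructor <;> linarith
  have hpos : P₀ (Metric.ball (q : ℝ) r) ≠ 0 :=
    ((Measure.mem_support_iff_forall v).1 hv _ (Metric.isOpen_ball.mem_nhds hvq)).ne'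
  obtain ⟨k, hk⟩ := hω q r s n hpos hs
  refine ⟨k, fun x hx => ?_⟩
  have h1 := hk x hx
  rw [Metric.mem_ball] at h1 hvq
  rw [← Real.dist_eq]
  have := dist_triangle_right (V x ω) v q
  linarith

end Probability

end SierpinskiAnderson

end

/-! ### The almost sure inclusions -/

open SierpinskiAnderson in
theorem theorem1p1 {Ω : Type*} [MeasurableSpace Ω] (P : Measure Ω) [IsProbabilityMeasure P]
    (P₀ : Measure ℝ) (V : SierpinskiAnderson.Vertex → Ω → ℝ)
    (hmeas : ∀ x, Measurable (V x)) (hindep : iIndepFun V P)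
    (hlaw : ∀ x, Measure.map (V x) P = P₀) :
    (∀ᵐ ω ∂P,
      SierpinskiAnderson.opSpectrum SierpinskiAnderson.free + Complex.ofReal '' P₀.support
          ⊆ SierpinskiAnderson.opSpectrum (SierpinskiAnderson.hamiltonian fun x => V x ω) ∧
      SierpinskiAnderson.opSpectrum (SierpinskiAnderson.hamiltonian fun x => V x ω)
          ⊆ SierpinskiAnderson.opSpectrum SierpinskiAnderson.free +
            Complex.ofReal '' SierpinskiAnderson.valueInterval (fun x => V x ω) ∧
      SierpinskiAnderson.opSpectrum (SierpinskiAnderson.hamiltonian fun x => V x ω)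
          ⊆ Complex.ofReal '' (Set.Icc 0 6 + P₀.support)) ∧
    (P₀.support.OrdConnected →
      ∀ᵐ ω ∂P,
        SierpinskiAnderson.opSpectrum (SierpinskiAnderson.hamiltonian fun x => V x ω)
          = SierpinskiAnderson.opSpectrum SierpinskiAnderson.free +
            Complex.ofReal '' P₀.support) := by
  have hvals : ∀ᵐ ω ∂P, ∀ x, V x ω ∈ P₀.support := by
    rw [ae_all_iff]
    intro x
    have h : ∀ᵐ v ∂P₀, v ∈ P₀.support := Measure.support_mem_ae
    rw [← hlaw x] at h ⊢
    exact ae_of_ae_map (hmeas x).aemeasurable h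
  have hlower : ∀ᵐ ω ∂P, opSpectrum free + Complex.ofReal '' P₀.support ⊆
      opSpectrum (hamiltonian fun x => V x ω) := by
    filter_upwards [ae_exists_translate hmeas hindep hlaw] with ω hω
    rintro _ ⟨z, hz, _, ⟨v, hv, rfl⟩, rfl⟩
    obtain ⟨t, rfl⟩ := exists_ofReal_of_mem_opSpectrum (free_eq_hamiltonian ▸ hz)
    have := add_mem_opSpectrum_hamiltonian hz (hω v hv)
    rwa [Complex.ofReal_add] at this
  refine ⟨?_, fun hconn => ?_⟩
  · filter_upwards [hvals, hlower] with ω hω hlow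
    obtain ⟨x₀⟩ := (inferInstance : Nonempty Vertex)
    exact ⟨hlow, opSpectrum_hamiltonian_subset_add_valueInterval _,
      opSpectrum_hamiltonian_subset_Icc_add Measure.isClosed_support ⟨_, hω x₀⟩ hω⟩
  · filter_upwards [hvals, hlower] with ω hω hlow
    refine Set.Subset.antisymm ?_ hlow
    exact (opSpectrum_hamiltonian_subset_add_valueInterval _).trans (Set.add_subset_add_left
      (Set.image_mono (valueInterval_subset Measure.isClosed_support hconn hω)))
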